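/- Let $G$ be a finite undirected graph with $n\ge 1$ vertices; multiple edges are allowed, and each vertex carries at most one self-loop. An orientation of $G$ assigns to each edge which of its ends is the tail and which is the head (a self-loop has only one orientation); a sink is a vertex that is not the tail of any edge. Assume that no connected component of $G$ is a tree, i.e. that $G$ has a sink-free orientation. An $n$-cycle is a ring of $n$ vertices (a $1$-cycle is a vertex with a self-loop, a $2$-cycle is two vertices joined by two parallel edges); an $n$-lollipop is a path with $n$ vertices and $n-1$ edges, with a self-loop added at one end. Let $X_{e,k}$ ($e$ an edge, $k\ge 0$) be independent random variables, where $X_{e,k}$ is a uniformly distributed orientation of $e$, and let $\mathcal F_0$ be the $\sigma$-field generated by the variables $X_{e,0}$. Sink popping starts from the orientation $(X_{e,0})_e$ and, as long as the current orientation is not sink-free, chooses a sink by an arbitrary rule and pops it: for every edge $e$ incident to that sink the current arrow $X_{e,j}$ is replaced by $X_{e,j+1}$. Let $\tau\in\{0,1,2,\dots\}\cup\{\infty\}$ be the number of pops until the orientation is sink-free. Then, for every rule for choosing the sinks, $\tau$ is measurable and, almost surely, $$\mathbf E(\tau\mid\mathcal F_0)\le n(n-1).$$ Moreover, almost surely,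 equality holds if and only if one of the following is the case: 1. $G$ is an $n$-lollipop, and each edge is initially oriented opposite to its orientation in the unique sink-free orientation of $G$ (the self-loop having only one orientation); 2. $n=2$, $G$ is a $2$-cycle, and its two edges initially point to the same vertex. An $n$-lollipop does have exactly one sink-free orientation. -/

import Mathlib

open MeasureTheory ProbabilityTheory
open scoped ENNReal Graph

noncomputable section

namespace Graph

variable {α β : Type*}

/-- `v 0, …, v n` and `e 0, …, e n` are the vertices and the edges of a cycle of length `n + 1`
in `G`: the vertices are distinct, the edges are distinct, and `e i` joins `v i` to `v (i + 1)`
(indices modulo `n + 1`). For `n = 0` this is a self-loop, for `n = 1` a pair of parallel edges. -/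
structure IsCycleIn (G : Graph α β) {n : ℕ} (v : Fin (n + 1) → α) (e : Fin (n + 1) → β) :
    Prop where
  vertex_injective : Function.Injective v
  edge_injective : Function.Injective e
  isLink : ∀ i, G.IsLink (e i) (v i) (v (i + 1))

/-- `G` is (exactly) an `n`-cycle: a ring of `n ≥ 1` vertices. -/
def IsNCycle (G : Graph α β) (n : ℕ) : Prop :=
  ∃ (k : ℕ) (v : Fin (k + 1) → α) (e : Fin (k + 1) → β),
    n = k + 1 ∧ G.IsCycleIn v e ∧ Set.range v = V(G) ∧ Set.range e = E(G)

/-- `G` is (exactly) an `n`-lollipop, `n ≥ 1`: a path with vertices `v 0, …, v k` and edges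
`e 0, …, e (k - 1)`, where `k + 1 = n`, with a self-loop `e k` added at its end `v k`. -/
def IsNLollipop (G : Graph α β) (n : ℕ) : Prop :=
  ∃ (k : ℕ) (v : Fin (k + 1) → α) (e : Fin (k + 1) → β),
    n = k + 1 ∧ Function.Injective v ∧ Function.Injective e ∧
    Set.range v = V(G) ∧ Set.range e = E(G) ∧
    (∀ i : Fin k, G.IsLink (e i.castSucc) (v i.castSucc) (v i.succ)) ∧
    G.IsLoopAt (e (Fin.last k)) (v (Fin.last k))

/-- A tree: a nonempty connected graph that contains no cycle. -/
structure IsMultiTree (G : Graph α β) : Prop where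
  nonempty : V(G).Nonempty
  connected : ∀ x ∈ V(G), ∀ y ∈ V(G), Relation.ReflTransGen G.Adj x y
  acyclic : ∀ (n : ℕ) (v : Fin (n + 1) → α) (e : Fin (n + 1) → β), ¬ G.IsCycleIn v e

/-- The connected component of the vertex `x`. -/
def component (G : Graph α β) (x : α) : Graph α β :=
  G.induce {y | Relation.ReflTransGen G.Adj x y}

/-- No connected component of `G` is a tree. -/
def NoTreeComponent (G : Graph α β) : Prop :=
  ∀ x ∈ V(G), ¬ (G.component x).IsMultiTree

/-- An orientation of the edge `e`: an ordered pair (tail, head) of its ends. A self-loop has one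
orientation, any other edge has two. -/
def EdgeOrientation (G : Graph α β) (e : β) : Type _ :=
  {p : α × α // G.IsLink e p.1 p.2}

namespace EdgeOrientation

variable {G : Graph α β} {e : β}

def tail (o : G.EdgeOrientation e) : α := o.1.1

def head (o : G.EdgeOrientation e) : α := o.1.2

/-- Swap head and tail. -/
def reverse (o : G.EdgeOrientation e) : G.EdgeOrientation e := ⟨(o.1.2, o.1.1), o.2.symm⟩

instance : MeasurableSpace (G.EdgeOrientation e) := ⊤

instance (e : E(G)) : Nonempty (G.EdgeOrientation e) := by
  obtain ⟨x, y, h⟩ := G.exists_isLink_of_mem_edgeSet e.2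
  exact ⟨⟨(x, y), h⟩⟩

instance [Finite V(G)] : Finite (G.EdgeOrientation e) :=
  Finite.of_injective
    (fun o => ((⟨o.1.1, o.2.left_mem⟩, ⟨o.1.2, o.2.right_mem⟩) : V(G) × V(G))) (by
      rintro ⟨⟨a, b⟩, h⟩ ⟨⟨c, d⟩, h'⟩ hab
      simp only [Prod.mk.injEq, Subtype.mk.injEq] at hab
      exact Subtype.ext (Prod.ext hab.1 hab.2))

end EdgeOrientation

/-- An orientation of `G` is an orientation of each edge. -/
abbrev Orientation (G : Graph α β) : Type _ := (e : E(G)) → G.EdgeOrientation e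

namespace Orientation

variable {G : Graph α β}

/-- The orientation in which every edge is reversed. -/
def reverse (o : G.Orientation) : G.Orientation := fun e => (o e).reverse

/-- A sink is a vertex that is not the tail of any edge. -/
def IsSink (o : G.Orientation) (x : α) : Prop := x ∈ V(G) ∧ ∀ e, (o e).tail ≠ x

/-- Sink-free orientations. -/
def IsSinkFree (o : G.Orientation) : Prop := ∀ x, ¬ o.IsSink x

end Orientation

/-- The sample space: sequences of orientations of `G`. The entry `ω k e` is the `k`-th arrow in
the stack under the edge `e`. It carries the product `σ`-algebra, which is generated by the
coordinates `ω ↦ ω k e`. -/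
abbrev Stacks (G : Graph α β) : Type _ := ℕ → G.Orientation

/-- The law under which all coordinates `ω k e` are independent and each of them is uniformly
distributed on the orientations of `e`. -/
def stackMeasure (G : Graph α β) : Measure G.Stacks :=
  Measure.infinitePi fun _ : ℕ => Measure.infinitePi fun e : E(G) =>
    uniformOn (Set.univ : Set (G.EdgeOrientation e))

instance (G : Graph α β) [Finite V(G)] : IsProbabilityMeasure G.stackMeasure := by
  unfold stackMeasure
  infer_instance

/-- The `σ`-algebra generated by the initial orientation `ω 0`. -/
abbrev initialSigma (G : Graph α β) : MeasurableSpace G.Stacks :=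
  MeasurableSpace.comap (fun ω : G.Stacks => ω 0) inferInstance

/-- The orientation that is visible on top of the stacks when `f e` arrows have been removed from
the stack under each edge `e`. -/
def top {G : Graph α β} (ω : G.Stacks) (f : E(G) → ℕ) : G.Orientation := fun e => ω (f e) e

open scoped Classical in
/-- `depth ω v k e` is the number of arrows removed from the stack under `e` in the first `k`
steps, when the vertex popped at step `i` is `v i`: popping a vertex removes the top arrow of each
edge incident to it, and once the orientation is sink-free nothing is popped any more. -/
def depth {G : Graph α β} (ω : G.Stacks) (v : ℕ → α) : ℕ → E(G) → ℕ
  | 0 => fun _ => 0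
  | k + 1 => fun e =>
    if (top ω (depth ω v k)).IsSinkFree then depth ω v k e
    else if G.Inc e (v k) then depth ω v k e + 1 else depth ω v k e

/-- The orientation after `k` steps of sink popping. -/
def orientationAt {G : Graph α β} (ω : G.Stacks) (v : ℕ → α) (k : ℕ) : G.Orientation :=
  top ω (depth ω v k)

/-- A choice rule: as long as the orientation is not sink-free, the vertex `c ω k` chosen for
popping at step `k` is a sink of the current orientation. The choice may depend on `ω` in an
arbitrary way. -/
def IsChoiceRule (G : Graph α β) (c : G.Stacks → ℕ → α) : Prop :=
  ∀ ω k, ¬ (orientationAt ω (c ω) k).IsSinkFree → (orientationAt ω (c ω) k).IsSink (c ω k)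

/-- The running time: the number of pops before the orientation is sink-free, or `∞`. -/
def runningTime {G : Graph α β} (c : G.Stacks → ℕ → α) (ω : G.Stacks) : ℝ≥0∞ :=
  ⨅ (k : ℕ) (_ : (orientationAt ω (c ω) k).IsSinkFree), (k : ℝ≥0∞)

end Graph

end

/-! The number of pops does not depend on the rule: no legal run pops a vertex more often than a
legal run that has terminated (`IsLegal.popCount_le`). The sink may therefore be chosen as a
function of the current orientation. Sink popping is then a Markov chain on orientations, and
conditioning on the initial layer means starting this chain at `ω 0`.

Let `N x` be the expected number of pops of `x`. Two functionals of the chain control `N`. For an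
edge between `x ≠ y`, the sign that is `1` if its tail is `x` and `-1` otherwise has drift `+1` when
`x` is popped and `-1` when `y` is popped (`transition_tailSign`). Hence `N x - N y` is the expected
change of a sign: at most `2`, and at most `0` if the tail is `x` at the start. Along a cycle of
length `m ≥ 2`, the squared circulation has drift `2` at each pop on the cycle
(`transition_circulation_sq`). It never exceeds `m²`, so `N` sums to at most `m² / 2` over the
cycle. A vertex with a loop is never popped.

The rest is deterministic (`PopBounds.isBounded`). If `s` vertices have sum at most `s (s - 1)` and
maximum at most `2 (s - 1)`, a neighbour has `N ≤ 2 s`, and `s (s - 1) + 2 s = (s + 1) s`, so both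
bounds survive its addition. They also hold for cycles and disjoint unions. As no component is a
tree, all of `G` is reached. Equality at every stage leaves only a path grown from a loop, or a
2-cycle. Conversely, in these two cases the relevant functional has a known value on sink-free
orientations, so the drift identities give matching lower bounds. -/

noncomputable section

namespace Graph

variable {α β : Type*} {G : Graph α β}

namespace EdgeOrientation

variable {e : β}

lemma inc_head (o : G.EdgeOrientation e) : G.Inc e o.head := o.2.inc_right

lemma inc_tail (o : G.EdgeOrientation e) : G.Inc e o.tail := o.2.inc_left

lemma head_eq_of_inc_of_tail_ne (o : G.EdgeOrientation e) {x : α} (h : G.Inc e x)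
    (hx : o.tail ≠ x) : o.head = x :=
  (h.eq_of_isLink_of_ne_left o.2 (Ne.symm hx)).symm

@[simp] lemma tail_reverse (o : G.EdgeOrientation e) : o.reverse.tail = o.head := rfl

@[simp] lemma reverse_reverse (o : G.EdgeOrientation e) : o.reverse.reverse = o := rfl

end EdgeOrientation

/-! ### Independence of the running time from the choice rule -/

section Confluence

open scoped Classical

/-- `v` pops a sink at every step before the orientation is sink-free. -/
def IsLegal (ω : G.Stacks) (v : ℕ → α) : Prop :=
  ∀ k, ¬ (orientationAt ω v k).IsSinkFree → (orientationAt ω v k).IsSink (v k)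

/-- The number of times that `x` is popped in the first `k` steps. -/
def popCount (ω : G.Stacks) (v : ℕ → α) (k : ℕ) (x : α) : ℕ :=
  ((Finset.range k).filter fun i => ¬ (orientationAt ω v i).IsSinkFree ∧ v i = x).card

lemma popCount_succ (ω : G.Stacks) (v : ℕ → α) (k : ℕ) (x : α) :
    popCount ω v (k + 1) x = popCount ω v k x +
      if ¬ (orientationAt ω v k).IsSinkFree ∧ v k = x then 1 else 0 := by
  unfold popCount
  rw [Finset.range_add_one, Finset.filter_insert]
  split_ifs with h
  · rw [Finset.card_insert_of_notMem (by simp)]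
  · simp

lemma depth_succ (ω : G.Stacks) (v : ℕ → α) (k : ℕ) (e : E(G)) :
    depth ω v (k + 1) e = depth ω v k e +
      if ¬ (orientationAt ω v k).IsSinkFree ∧ G.Inc e (v k) then 1 else 0 := by
  rw [depth]
  by_cases h : (top ω (depth ω v k)).IsSinkFree <;> by_cases h' : G.Inc e (v k) <;>
    simp [orientationAt, h, h']

lemma depth_succ_of_isSinkFree {ω : G.Stacks} {v : ℕ → α} {k : ℕ}
    (h : (orientationAt ω v k).IsSinkFree) : depth ω v (k + 1) = depth ω v k := by
  funext e
  simp [depth_succ, h]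

lemma isSinkFree_orientationAt_mono {ω : G.Stacks} {v : ℕ → α} {k l : ℕ} (hkl : k ≤ l)
    (h : (orientationAt ω v k).IsSinkFree) : (orientationAt ω v l).IsSinkFree := by
  induction l, hkl using Nat.le_induction with
  | base => exact h
  | succ l _ ih => rwa [orientationAt, depth_succ_of_isSinkFree ih]

/-- The pops of `x` are recorded by the stack under any edge incident to `x`. -/
lemma IsLegal.popCount_eq {ω : G.Stacks} {v : ℕ → α} (hv : IsLegal ω v) {x : α} (e : E(G))
    (hx : G.Inc e x) (k : ℕ) :
    popCount ω v k x =
      ((Finset.range (depth ω v k e)).filter fun i => (ω i e).head = x).card := by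
  induction k with
  | zero => simp [popCount, depth]
  | succ k ih =>
    rw [popCount_succ, depth_succ, ih]
    by_cases hs : (orientationAt ω v k).IsSinkFree
    · simp [hs]
    by_cases hi : G.Inc e (v k)
    · have hh : (ω (depth ω v k e) e).head = v k :=
        EdgeOrientation.head_eq_of_inc_of_tail_ne _ hi ((hv k hs).2 e)
      simp only [hs, hi, not_false_eq_true, true_and, and_self, if_true]
      rw [Finset.range_add_one, Finset.filter_insert, hh]
      split_ifs with h
      · rw [Finset.card_insert_of_notMem (by simp)]
      · simp
    · have : v k ≠ x := fun h => hi (h ▸ hx)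
      simp [hs, hi, this]

lemma IsLegal.popCount_add_popCount {ω : G.Stacks} {v : ℕ → α} (hv : IsLegal ω v) {x y : α}
    (e : E(G)) (he : G.IsLink e x y) (hxy : x ≠ y) (k : ℕ) :
    popCount ω v k x + popCount ω v k y = depth ω v k e := by
  rw [hv.popCount_eq e he.inc_left, hv.popCount_eq e he.inc_right,
    ← Finset.card_union_of_disjoint, ← Finset.filter_or, Finset.filter_true_of_mem,
    Finset.card_range]
  · intro i _
    exact (ω i e).inc_head.eq_or_eq_of_isLink he
  · rw [Finset.disjoint_filter]
    rintro i _ h h'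
    exact hxy (h.symm.trans h')

/-- At the first step where `v` would pop a vertex more often than `w` did in `k` steps, that vertex
would still be a sink in the final orientation of `w`. -/
lemma IsLegal.popCount_le {ω : G.Stacks} {v w : ℕ → α} (hv : IsLegal ω v) (hw : IsLegal ω w)
    {k : ℕ} (hk : (orientationAt ω w k).IsSinkFree) (j : ℕ) (x : α) :
    popCount ω v j x ≤ popCount ω w k x := by
  induction j generalizing x with
  | zero => simp [popCount]
  | succ j ih =>
    rw [popCount_succ]
    split_ifs with h
    swap
    · simpa using ih x
    obtain ⟨hs, rfl⟩ := h
    refine Nat.succ_le_of_lt (lt_of_le_of_ne (ih _) fun heq => hk (v j) ?_)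
    refine ⟨(hv j hs).1, fun e ht => ?_⟩
    have hinc : G.Inc e (v j) := ht ▸ EdgeOrientation.inc_tail _
    have htail : (ω (depth ω v j e) e).tail ≠ v j := (hv j hs).2 e
    have hhead := EdgeOrientation.head_eq_of_inc_of_tail_ne _ hinc htail
    have hlink : G.IsLink e (ω (depth ω v j e) e).tail (v j) := by
      have := (ω (depth ω v j e) e).2
      rwa [show (ω (depth ω v j e) e).1.2 = v j from hhead] at this
    -- The depth of a non-loop edge is the total number of pops of its two ends.
    have hle : depth ω v j e ≤ depth ω w k e := by
      rw [← hv.popCount_add_popCount e hlink htail, ← hw.popCount_add_popCount e hlink htail]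
      exact Nat.add_le_add (ih _) (ih _)
    -- At equal depth both runs see the same arrow, which cannot point both to and away from `v j`.
    -- If `w` is deeper, it has removed an arrow pointing to `v j` that `v` has not, so its pop
    -- count at `v j` is strictly larger.
    rcases hle.eq_or_lt with hd | hd
    · apply htail
      rw [hd]
      exact ht
    · rw [hv.popCount_eq e hinc, hw.popCount_eq e hinc] at heq
      refine absurd heq (ne_of_lt (Finset.card_lt_card ?_))
      refine Finset.ssubset_iff_subset_ne.2 ⟨Finset.filter_subset_filter _ ?_, fun h => ?_⟩
      · exact Finset.range_subset_range.2 hle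
      · have : depth ω v j e ∈
            (Finset.range (depth ω v j e)).filter fun i => (ω i e).head = v j := by
          rw [h]
          simp [hd, hhead]
        simp at this

lemma IsLegal.sum_popCount [Finite V(G)] {ω : G.Stacks} {v : ℕ → α} (hv : IsLegal ω v) (k : ℕ) :
    ∑ x ∈ (Set.toFinite V(G)).toFinset, popCount ω v k x =
      ((Finset.range k).filter fun i => ¬ (orientationAt ω v i).IsSinkFree).card := by
  rw [Finset.card_eq_sum_card_fiberwise (f := v) (t := (Set.toFinite V(G)).toFinset)]
  · simp only [popCount, Finset.filter_filter]
  · intro i hi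
    simp only [Finset.coe_filter, Set.mem_ofPred_eq] at hi
    simpa using (hv i hi.2).1

/-- Otherwise `v` would make `k + 1` pops in its first `k + 1` steps, while `w` makes at most `k` in
all. -/
lemma IsLegal.isSinkFree_of_isSinkFree [Finite V(G)] {ω : G.Stacks} {v w : ℕ → α}
    (hv : IsLegal ω v) (hw : IsLegal ω w) {k : ℕ} (hk : (orientationAt ω w k).IsSinkFree) :
    (orientationAt ω v k).IsSinkFree := by
  by_contra h
  have hle := Finset.sum_le_sum fun x (_ : x ∈ (Set.toFinite V(G)).toFinset) =>
    hv.popCount_le hw hk (k + 1) x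
  rw [hv.sum_popCount, hw.sum_popCount, Finset.filter_true_of_mem, Finset.card_range] at hle
  · have := hle.trans (Finset.card_filter_le _ _)
    simp at this
  · intro i hi hs
    exact h (isSinkFree_orientationAt_mono (Nat.lt_succ_iff.1 (Finset.mem_range.1 hi)) hs)

lemma runningTime_congr [Finite V(G)] {c d : G.Stacks → ℕ → α} (hc : G.IsChoiceRule c)
    (hd : G.IsChoiceRule d) : runningTime c = runningTime d := by
  funext ω
  have h (k : ℕ) : (orientationAt ω (c ω) k).IsSinkFree ↔ (orientationAt ω (d ω) k).IsSinkFree :=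
    ⟨IsLegal.isSinkFree_of_isSinkFree (hd ω) (hc ω),
      IsLegal.isSinkFree_of_isSinkFree (hc ω) (hd ω)⟩
  simp only [runningTime, h]

/-- A sum of indicators can be integrated term by term, the value `∞` included. -/
lemma runningTime_eq_tsum (c : G.Stacks → ℕ → α) (ω : G.Stacks) :
    runningTime c ω = ∑' k, if (orientationAt ω (c ω) k).IsSinkFree then (0 : ℝ≥0∞) else 1 := by
  by_cases h : ∃ k, (orientationAt ω (c ω) k).IsSinkFree
  · have hk : ∀ k, (orientationAt ω (c ω) k).IsSinkFree ↔ Nat.find h ≤ k := fun k =>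
      ⟨fun hk => Nat.find_min' h hk, fun hk => isSinkFree_orientationAt_mono hk (Nat.find_spec h)⟩
    rw [tsum_eq_sum (s := Finset.range (Nat.find h))]
    · rw [Finset.sum_congr rfl (g := fun _ => 1)]
      · simp only [Finset.sum_const, Finset.card_range, nsmul_eq_mul, mul_one]
        refine le_antisymm (iInf₂_le (f := fun (k : ℕ) _ => (k : ℝ≥0∞)) (Nat.find h)
          (Nat.find_spec h)) (le_iInf₂ fun k h' => ?_)
        exact_mod_cast (hk k).1 h'
      · intro k hk'
        rw [if_neg]
        rw [hk]
        simpa using hk'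
    · intro k hk'
      rw [if_pos]
      rw [hk]
      simpa using hk'
  · push Not at h
    simp [runningTime, h]

end Confluence

/-! ### Removing arrows and adding fresh ones; the law of the stacks -/

section Resampling

open scoped Classical

/-- Replace the orientations of the edges in `S` by those of `r`. -/
def resample (S : Set E(G)) (r o : G.Orientation) : G.Orientation :=
  fun e => if e ∈ S then r e else o e

/-- Remove the top arrow from the stacks under the edges in `S`. -/
def advance (S : Set E(G)) (ω : G.Stacks) : G.Stacks :=
  fun k e => if e ∈ S then ω (k + 1) e else ω k e

/-- Put the arrows of `r` on top of the stacks under the edges in `S`. -/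
def push (S : Set E(G)) (r : G.Orientation) (ω : G.Stacks) : G.Stacks :=
  fun k e => if e ∈ S then (if k = 0 then r e else ω (k - 1) e) else ω k e

/-- This is the Markov property at the level of stacks: if the arrows below `o` on `S` are fresh,
removing the top ones resamples `o` on `S` and leaves `ω` untouched underneath. -/
lemma advance_push (S : Set E(G)) (r o : G.Orientation) (ω : G.Stacks) :
    advance S (push Set.univ o (push S r ω)) = push Set.univ (resample S r o) ω := by
  funext k e
  by_cases he : e ∈ S <;> cases k <;> simp [advance, push, resample, he]

@[simp] lemma push_univ_zero (o : G.Orientation) (ω : G.Stacks) : push Set.univ o ω 0 = o := by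
  funext e
  simp [push]

end Resampling

section Law

open scoped Classical

variable (G)

/-- The law of a uniformly distributed orientation. -/
def orientationMeasure : Measure G.Orientation :=
  Measure.infinitePi fun e : E(G) => uniformOn (Set.univ : Set (G.EdgeOrientation e))

instance [Finite V(G)] : IsProbabilityMeasure G.orientationMeasure := by
  unfold orientationMeasure
  infer_instance

variable {G}

lemma measurableSet_arrows {e : β} (t : Set (G.EdgeOrientation e)) : MeasurableSet t := trivial

lemma measurable_push (S : Set E(G)) :
    Measurable fun p : G.Orientation × G.Stacks => push S p.1 p.2 := by
  refine measurable_pi_lambda _ fun k => measurable_pi_lambda _ fun e => ?_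
  unfold push
  split_ifs <;> fun_prop

lemma measurable_advance (S : Set E(G)) : Measurable (advance S) := by
  refine measurable_pi_lambda _ fun k => measurable_pi_lambda _ fun e => ?_
  unfold advance
  split_ifs <;> fun_prop

lemma stackMeasure_eq_map_piCurry [Finite V(G)] :
    G.stackMeasure = (Measure.infinitePi fun p : (_ : ℕ) × E(G) =>
      uniformOn (Set.univ : Set (G.EdgeOrientation p.2))).map
        (MeasurableEquiv.piCurry fun (_ : ℕ) (e : E(G)) => G.EdgeOrientation e) :=
  (Measure.infinitePi_map_piCurry fun (_ : ℕ) (e : E(G)) =>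
    uniformOn (Set.univ : Set (G.EdgeOrientation e))).symm

lemma measurableSet_box (s : Finset ((_ : ℕ) × E(G)))
    (t : (p : (_ : ℕ) × E(G)) → Set (G.EdgeOrientation p.2)) :
    MeasurableSet {ω : G.Stacks | ∀ p ∈ s, ω p.1 p.2 ∈ t p} := by
  have : {ω : G.Stacks | ∀ p ∈ s, ω p.1 p.2 ∈ t p} =
      ⋂ p ∈ s, (fun ω : G.Stacks => ω p.1 p.2) ⁻¹' t p := by
    ext ω
    simp
  rw [this]
  refine Finset.measurableSet_biInter _ fun p _ => ?_
  have hm : Measurable fun ω : G.Stacks => ω p.1 p.2 := by fun_prop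
  exact hm (measurableSet_arrows _)

lemma stackMeasure_box [Finite V(G)] (s : Finset ((_ : ℕ) × E(G)))
    (t : (p : (_ : ℕ) × E(G)) → Set (G.EdgeOrientation p.2)) :
    G.stackMeasure {ω | ∀ p ∈ s, ω p.1 p.2 ∈ t p} =
      ∏ p ∈ s, uniformOn (Set.univ : Set (G.EdgeOrientation p.2)) (t p) := by
  rw [stackMeasure_eq_map_piCurry, Measure.map_apply (MeasurableEquiv.measurable _)
    (measurableSet_box s t), ← Measure.infinitePi_pi (t := t)
      _ fun p _ => measurableSet_arrows (t p)]
  rfl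

lemma eq_stackMeasure_of_box [Finite V(G)] {ν : Measure G.Stacks}
    (h : ∀ (s : Finset ((_ : ℕ) × E(G))) (t : (p : (_ : ℕ) × E(G)) → Set (G.EdgeOrientation p.2)),
      ν {ω | ∀ p ∈ s, ω p.1 p.2 ∈ t p} =
        ∏ p ∈ s, uniformOn (Set.univ : Set (G.EdgeOrientation p.2)) (t p)) :
    ν = G.stackMeasure := by
  rw [stackMeasure_eq_map_piCurry, eq_comm,
    MeasurableEquiv.map_apply_eq_iff_map_symm_apply_eq, eq_comm]
  refine Measure.eq_infinitePi _ fun s t _ => ?_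
  rw [Measure.map_apply (MeasurableEquiv.measurable _)
    (MeasurableSet.pi s.countable_toSet fun _ _ => measurableSet_arrows _), ← h s t]
  rfl

/-- Fresh uniform arrows on top of independent stacks give stacks with the same law. -/
lemma measurePreserving_push [Finite V(G)] (S : Set E(G)) :
    MeasurePreserving (fun p : G.Orientation × G.Stacks => push S p.1 p.2)
      (G.orientationMeasure.prod G.stackMeasure) G.stackMeasure := by
  refine ⟨measurable_push S, eq_stackMeasure_of_box fun s t => ?_⟩
  rw [Measure.map_apply (measurable_push S) (measurableSet_box s t)]
  -- After the push, the arrow at `p` comes from `r` if `q p`, and otherwise from position `φ p` of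
  -- `ω`; `t'` is the constraint carried along `φ`. The truncated subtraction is harmless, since
  -- `p.1 = 0` with `p.2 ∈ S` falls under `q`.
  let φ : (_ : ℕ) × E(G) → (_ : ℕ) × E(G) := fun p => ⟨if p.2 ∈ S then p.1 - 1 else p.1, p.2⟩
  let t' : (p : (_ : ℕ) × E(G)) → Set (G.EdgeOrientation p.2) :=
    fun p => if p.2 ∈ S then t ⟨p.1 + 1, p.2⟩ else t p
  let q : (_ : ℕ) × E(G) → Prop := fun p => p.2 ∈ S ∧ p.1 = 0
  let A := (s.filter q).image Sigma.snd
  let B := (s.filter fun p => ¬ q p).image φ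
  have hsnd : Set.InjOn Sigma.snd (s.filter q : Set ((_ : ℕ) × E(G))) := by
    rintro ⟨i, e⟩ hi ⟨j, f⟩ hj h
    simp only [Finset.coe_filter, Set.mem_ofPred_eq, q] at hi hj h
    obtain rfl := hi.2.2
    obtain rfl := hj.2.2
    rw [h]
  have hφ : Set.InjOn φ (s.filter fun p => ¬ q p : Set ((_ : ℕ) × E(G))) := by
    rintro ⟨i, e⟩ hi ⟨j, f⟩ hj h
    simp only [Finset.coe_filter, Set.mem_ofPred_eq, q, φ, Sigma.mk.injEq, heq_eq_eq] at hi hj h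
    obtain ⟨h, rfl⟩ := h
    by_cases he : e ∈ S
    · simp only [he, if_true, true_and] at hi hj h
      rw [show i = j by omega]
    · simp only [he, if_false] at h
      rw [h]
  have ht' : ∀ p ∈ s.filter fun p => ¬ q p, t' (φ p) = t p := by
    rintro ⟨i, e⟩ hi
    simp only [Finset.mem_filter, q] at hi
    by_cases he : e ∈ S
    · obtain ⟨i, rfl⟩ : ∃ j, i = j + 1 := ⟨i - 1, by simp only [he, true_and] at hi; omega⟩
      have h : ∀ j, j = i → t' ⟨j, e⟩ = t' ⟨i, e⟩ := by
        rintro _ rfl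
        rfl
      exact (h (if e ∈ S then i + 1 - 1 else i + 1) (by simp [he])).trans (by simp [t', he])
    · have h : ∀ j, j = i → t' ⟨j, e⟩ = t' ⟨i, e⟩ := by
        rintro _ rfl
        rfl
      exact (h (if e ∈ S then i - 1 else i) (by simp [he])).trans (by simp [t', he])
  have hpre : (fun p : G.Orientation × G.Stacks => push S p.1 p.2) ⁻¹'
      {ω | ∀ p ∈ s, ω p.1 p.2 ∈ t p} =
      (Set.pi A fun e => t ⟨0, e⟩) ×ˢ {ω | ∀ p ∈ B, ω p.1 p.2 ∈ t' p} := by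
    ext ⟨r, ω⟩
    simp only [Set.mem_preimage, Set.mem_ofPred_eq, Set.mem_prod, Set.mem_pi, A, B,
      Finset.coe_image, Finset.mem_image, Set.mem_image, forall_exists_index, and_imp]
    constructor
    · intro h
      constructor
      · rintro _ ⟨i, e⟩ hp rfl
        simp only [Finset.coe_filter, Set.mem_ofPred_eq, q] at hp
        obtain ⟨hs, he, rfl⟩ := hp
        simpa [push, he] using h _ hs
      · rintro _ p hp rfl
        rw [ht' p hp]
        obtain ⟨i, e⟩ := p
        simp only [Finset.mem_filter, q] at hp
        have := h _ hp.1
        by_cases he : e ∈ S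
        · have hi : i ≠ 0 := fun hi => hp.2 ⟨he, hi⟩
          simpa [push, φ, he, hi] using this
        · simpa [push, φ, he] using this
    · rintro ⟨h₁, h₂⟩ ⟨i, e⟩ hs
      by_cases hq : q ⟨i, e⟩
      · obtain ⟨he, hi⟩ := id hq
        simp only at he hi
        subst hi
        simpa [push, he] using h₁ e ⟨0, e⟩ (by simpa using ⟨hs, hq⟩) rfl
      · have hp : (⟨i, e⟩ : (_ : ℕ) × E(G)) ∈ s.filter fun p => ¬ q p := by simpa using ⟨hs, hq⟩
        have := h₂ _ ⟨i, e⟩ hp rfl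
        rw [ht' _ hp] at this
        by_cases he : e ∈ S
        · have hi : i ≠ 0 := fun hi => hq ⟨he, hi⟩
          simpa [push, φ, he, hi] using this
        · simpa [push, φ, he] using this
  rw [hpre, Measure.prod_prod, stackMeasure_box, orientationMeasure,
    Measure.infinitePi_pi _ fun _ _ => measurableSet_arrows _, Finset.prod_image hsnd, Finset.prod_image hφ,
    ← Finset.prod_filter_mul_prod_filter_not s q]
  congr 1
  · refine Finset.prod_congr rfl ?_
    rintro ⟨i, e⟩ hp
    simp only [Finset.mem_filter, q] at hp
    obtain ⟨_, _, rfl⟩ := hp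
    rfl
  · exact Finset.prod_congr rfl fun p hp => by rw [ht' p hp]

end Law

open scoped Classical

/-! ### A rule that depends only on the current orientation -/

section CanonicalRule

lemma measurable_push_right (S : Set E(G)) (r : G.Orientation) :
    Measurable fun ω : G.Stacks => push S r ω :=
  (measurable_push S).comp measurable_prodMk_left

/-- The indicator function of the orientations which have a sink. -/
def hasSink (o : G.Orientation) : ℝ := if o.IsSinkFree then 0 else 1

lemma hasSink_nonneg : 0 ≤ (hasSink : G.Orientation → ℝ) := by
  intro o
  unfold hasSink
  split_ifs <;> simp

variable [Nonempty α]

/-- A sink of `o`, if there is one. -/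
def chosenSink (o : G.Orientation) : α := Classical.epsilon o.IsSink

lemma isSink_chosenSink {o : G.Orientation} (h : ¬ o.IsSinkFree) : o.IsSink (chosenSink o) := by
  unfold Orientation.IsSinkFree at h
  push Not at h
  exact Classical.epsilon_spec h

/-- The edges incident to `x`. -/
def star (G : Graph α β) (x : α) : Set E(G) := {e | G.Inc e x}

/-- Pop the sink `chosenSink (ω 0)`, if the top orientation is not sink-free. -/
def popStep (ω : G.Stacks) : G.Stacks :=
  if (ω 0).IsSinkFree then ω else advance (G.star (chosenSink (ω 0))) ω

/-- The rule which pops the sink `chosenSink o` in the orientation `o`. -/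
def canonicalRule (ω : G.Stacks) (k : ℕ) : α := chosenSink (popStep^[k] ω 0)

/-- The chain shifts the stacks, whereas `orientationAt` reads fixed stacks at a growing depth; both
see the same arrows. -/
lemma popStep_iterate (ω : G.Stacks) (k j : ℕ) (e : E(G)) :
    popStep^[k] ω j e = ω (depth ω (canonicalRule ω) k e + j) e := by
  induction k generalizing j e with
  | zero => simp [depth]
  | succ k ih =>
    have h0 : popStep^[k] ω 0 = orientationAt ω (canonicalRule ω) k := by
      funext e
      simp [ih, orientationAt, top]
    rw [Function.iterate_succ_apply', popStep, depth_succ, canonicalRule, h0]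
    by_cases hs : (orientationAt ω (canonicalRule ω) k).IsSinkFree
    · simp [hs, ih]
    · by_cases hi : G.Inc e (chosenSink (orientationAt ω (canonicalRule ω) k))
      · simp only [hs, advance, star, Set.mem_ofPred_eq, hi, if_true, if_false, ih]
        simp [add_comm, add_left_comm]
      · simp only [hs, advance, star, Set.mem_ofPred_eq, hi, if_false, ih]
        simp

lemma popStep_iterate_zero (ω : G.Stacks) (k : ℕ) :
    popStep^[k] ω 0 = orientationAt ω (canonicalRule ω) k := by
  funext e
  simp [popStep_iterate, orientationAt, top]

variable (G) in
lemma isChoiceRule_canonicalRule : G.IsChoiceRule canonicalRule := by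
  intro ω k h
  rw [canonicalRule, popStep_iterate_zero]
  exact isSink_chosenSink h

lemma runningTime_canonicalRule (ω : G.Stacks) :
    runningTime canonicalRule ω = ∑' k, ENNReal.ofReal (hasSink (popStep^[k] ω 0)) := by
  rw [runningTime_eq_tsum]
  refine tsum_congr fun k => ?_
  rw [popStep_iterate_zero, hasSink]
  split_ifs <;> simp

end CanonicalRule

/-! ### The Markov chain on orientations and the conditional expectation -/

section Chain

variable [Finite V(G)] [Finite E(G)]

instance : Finite G.Orientation := Pi.finite

instance : Fintype G.Orientation := Fintype.ofFinite _

instance {e : β} : MeasurableSingletonClass (G.EdgeOrientation e) := ⟨fun _ => trivial⟩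

lemma orientationMeasure_singleton (o : G.Orientation) :
    G.orientationMeasure {o} = (Fintype.card G.Orientation : ℝ≥0∞)⁻¹ := by
  have hconst : ∀ o' : G.Orientation, G.orientationMeasure {o'} = G.orientationMeasure {o} := by
    intro o'
    have : Fintype E(G) := Fintype.ofFinite _
    unfold orientationMeasure
    rw [Measure.infinitePi_singleton_of_fintype, Measure.infinitePi_singleton_of_fintype]
    refine Finset.prod_congr rfl fun e _ => ?_
    have : Fintype (G.EdgeOrientation e) := Fintype.ofFinite _
    simp [uniformOn_univ]
  have hsum : ∑ o' : G.Orientation, G.orientationMeasure {o'} = 1 := by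
    rw [sum_measure_singleton, Finset.coe_univ, measure_univ]
  simp only [hconst, Finset.sum_const, Finset.card_univ, nsmul_eq_mul] at hsum
  exact ENNReal.eq_inv_of_mul_eq_one_left (by rwa [mul_comm])

lemma lintegral_orientationMeasure (F : G.Orientation → ℝ≥0∞) :
    ∫⁻ r, F r ∂G.orientationMeasure =
      (Fintype.card G.Orientation : ℝ≥0∞)⁻¹ * ∑ r, F r := by
  simp only [lintegral_fintype, orientationMeasure_singleton, ← Finset.sum_mul, mul_comm]

/-- With `S` the star of a sink this averages over one step of the chain; with `S = Set.univ` it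
disintegrates along the initial orientation. -/
lemma lintegral_stackMeasure_push (S : Set E(G)) {F : G.Stacks → ℝ≥0∞} (hF : Measurable F) :
    ∫⁻ ω, F ω ∂G.stackMeasure =
      (Fintype.card G.Orientation : ℝ≥0∞)⁻¹ * ∑ r, ∫⁻ ω, F (push S r ω) ∂G.stackMeasure := by
  rw [← (measurePreserving_push S).lintegral_comp hF,
    lintegral_prod (fun p : G.Orientation × G.Stacks => F (push S p.1 p.2))
      (hF.comp (measurable_push S)).aemeasurable,
    lintegral_orientationMeasure fun r => ∫⁻ ω, F (push S r ω) ∂G.stackMeasure]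

variable [Nonempty α]

lemma measurable_popStep : Measurable (popStep : G.Stacks → G.Stacks) := by
  let g : G.Orientation × G.Stacks → G.Stacks := fun p =>
    if p.1.IsSinkFree then p.2 else advance (G.star (chosenSink p.1)) p.2
  have hg : Measurable g := by
    refine measurable_from_prod_countable_right fun o => ?_
    by_cases ho : o.IsSinkFree
    · simp only [g, ho, if_true]
      exact measurable_id
    · simp only [g, ho, if_false]
      exact measurable_advance _
  have h0 : Measurable fun ω : G.Stacks => ω 0 := measurable_pi_apply 0
  exact hg.comp (h0.prodMk measurable_id)

/-- The transition operator of sink popping: `transition f o` is the expectation of `f` after one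
step from `o`. -/
def transition : Module.End ℝ (G.Orientation → ℝ) where
  toFun f o := if o.IsSinkFree then f o else
    (Fintype.card G.Orientation : ℝ)⁻¹ * ∑ r, f (resample (G.star (chosenSink o)) r o)
  map_add' f g := by
    funext o
    by_cases h : o.IsSinkFree <;> simp [h, Finset.sum_add_distrib, mul_add]
  map_smul' c f := by
    funext o
    by_cases h : o.IsSinkFree <;> simp [h, ← Finset.mul_sum, mul_left_comm]

lemma transition_apply (f : G.Orientation → ℝ) (o : G.Orientation) :
    transition f o = if o.IsSinkFree then f o else
      (Fintype.card G.Orientation : ℝ)⁻¹ * ∑ r, f (resample (G.star (chosenSink o)) r o) := rfl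

lemma transition_one : transition (1 : G.Orientation → ℝ) = 1 := by
  funext o
  by_cases h : o.IsSinkFree
  · simp [transition_apply, h]
  · have : (Fintype.card G.Orientation : ℝ) ≠ 0 := by
      have : Nonempty G.Orientation := ⟨o⟩
      exact_mod_cast Fintype.card_ne_zero
    simp [transition_apply, h, this]

lemma transition_mono {f g : G.Orientation → ℝ} (h : f ≤ g) : transition f ≤ transition g := by
  intro o
  simp only [transition_apply]
  split_ifs
  · exact h o
  · exact mul_le_mul_of_nonneg_left (Finset.sum_le_sum fun r _ => h _) (by positivity)

lemma transition_pow_one (k : ℕ) : (transition ^ k) (1 : G.Orientation → ℝ) = 1 := by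
  induction k with
  | zero => simp
  | succ k ih => rw [pow_succ, Module.End.mul_apply, transition_one, ih]

lemma transition_pow_mono {f g : G.Orientation → ℝ} (h : f ≤ g) (k : ℕ) :
    (transition ^ k) f ≤ (transition ^ k) g := by
  induction k with
  | zero => simpa using h
  | succ k ih =>
    rw [pow_succ', Module.End.mul_apply, Module.End.mul_apply]
    exact transition_mono ih

lemma transition_pow_nonneg {f : G.Orientation → ℝ} (h : 0 ≤ f) (k : ℕ) :
    0 ≤ (transition ^ k) f := by
  simpa using transition_pow_mono h k

lemma transition_pow_le_const {f : G.Orientation → ℝ} {c : ℝ} (h : ∀ o, f o ≤ c) (k : ℕ)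
    (o : G.Orientation) : (transition ^ k) f o ≤ c := by
  have := transition_pow_mono (g := c • (1 : G.Orientation → ℝ)) (fun o => by simpa using h o) k o
  simpa [transition_pow_one] using this

/-- Dynkin's formula, by telescoping: one-step drifts become identities for expected numbers of
pops. -/
lemma transition_pow_sub (f : G.Orientation → ℝ) (k : ℕ) (o : G.Orientation) :
    (transition ^ k) f o - f o =
      ∑ j ∈ Finset.range k, (transition ^ j) (transition f - f) o := by
  have h (j : ℕ) : (transition ^ j) (transition f - f) o =
      (transition ^ (j + 1)) f o - (transition ^ j) f o := by
    rw [map_sub, pow_succ, Module.End.mul_apply, Pi.sub_apply]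
  simp only [h]
  rw [Finset.sum_range_sub fun j => (transition ^ j) f o]
  simp

lemma lintegral_popStep_push {F : G.Stacks → ℝ≥0∞} (hF : Measurable F) {o : G.Orientation}
    (ho : ¬ o.IsSinkFree) :
    ∫⁻ ω, F (popStep (push Set.univ o ω)) ∂G.stackMeasure =
      (Fintype.card G.Orientation : ℝ≥0∞)⁻¹ * ∑ r, ∫⁻ ω,
        F (push Set.univ (resample (G.star (chosenSink o)) r o) ω) ∂G.stackMeasure := by
  rw [lintegral_stackMeasure_push (G.star (chosenSink o))
    (F := fun ω => F (popStep (push Set.univ o ω)))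
    (hF.comp (measurable_popStep.comp (measurable_push_right _ o)))]
  simp only [popStep, push_univ_zero, ho, if_false, advance_push]

/-- The law of the orientation after `k` steps is given by the powers of the transition operator. -/
lemma lintegral_popStep_iterate {f : G.Orientation → ℝ} (hf : 0 ≤ f) (k : ℕ) (o : G.Orientation) :
    ∫⁻ ω, ENNReal.ofReal (f (popStep^[k] (push Set.univ o ω) 0)) ∂G.stackMeasure =
      ENNReal.ofReal ((transition ^ k) f o) := by
  induction k generalizing o with
  | zero => simp
  | succ k ih =>
    have hm : Measurable fun ω : G.Stacks => ENNReal.ofReal (f (popStep^[k] ω 0)) :=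
      (Measurable.of_discrete (f := fun o : G.Orientation => ENNReal.ofReal (f o))).comp
        ((measurable_pi_apply 0).comp (measurable_popStep.iterate k))
    simp only [Function.iterate_succ_apply]
    rw [pow_succ', Module.End.mul_apply, transition_apply]
    by_cases ho : o.IsSinkFree
    · simp only [ho, if_true, popStep, push_univ_zero]
      exact ih o
    · rw [lintegral_popStep_push hm ho, if_neg ho, ENNReal.ofReal_mul (by positivity),
        ENNReal.ofReal_sum_of_nonneg fun r _ => transition_pow_nonneg hf k _]
      have : Nonempty G.Orientation := ⟨o⟩
      have hpos : (0 : ℝ) < Fintype.card G.Orientation := by exact_mod_cast Fintype.card_pos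
      rw [ENNReal.ofReal_inv_of_pos hpos, ENNReal.ofReal_natCast]
      simp only [ih]

lemma measurable_runningTime_canonicalRule :
    Measurable (runningTime (canonicalRule : G.Stacks → ℕ → α)) := by
  rw [show runningTime (canonicalRule : G.Stacks → ℕ → α) = _ from
    funext runningTime_canonicalRule]
  refine Measurable.tsum fun k => ?_
  exact (Measurable.of_discrete (f := fun o : G.Orientation => ENNReal.ofReal (hasSink o))).comp
    ((measurable_pi_apply 0).comp (measurable_popStep.iterate k))

/-- The expected running time of sink popping from the orientation `o`. -/
def expectedTime (o : G.Orientation) : ℝ≥0∞ := ∑' k, ENNReal.ofReal ((transition ^ k) hasSink o)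

lemma lintegral_runningTime_push (o : G.Orientation) :
    ∫⁻ ω, runningTime canonicalRule (push Set.univ o ω) ∂G.stackMeasure = expectedTime o := by
  simp only [runningTime_canonicalRule]
  rw [lintegral_tsum]
  · simp only [lintegral_popStep_iterate hasSink_nonneg, expectedTime]
  · intro k
    exact ((Measurable.of_discrete (f := fun o : G.Orientation => ENNReal.ofReal (hasSink o))).comp
      ((measurable_pi_apply 0).comp ((measurable_popStep.iterate k).comp
        (measurable_push_right _ o)))).aemeasurable

/-- On an event `ω 0 ∈ A`, both integrals are averages over the top layer `r`; once `r` is fixed the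
indicator is constant, and the remaining integral is `expectedTime r`. -/
lemma condLExp_runningTime {c : G.Stacks → ℕ → α} (hc : G.IsChoiceRule c) :
    (fun ω : G.Stacks => expectedTime (ω 0)) =ᵐ[G.stackMeasure]
      G.stackMeasure⁻[runningTime c | G.initialSigma] := by
  rw [runningTime_congr hc (isChoiceRule_canonicalRule G)]
  have hle : G.initialSigma ≤ (inferInstance : MeasurableSpace G.Stacks) :=
    (measurable_pi_apply 0).comap_le
  have hdisc : Measurable (expectedTime : G.Orientation → ℝ≥0∞) := Measurable.of_discrete
  refine ae_eq_condLExp hle _ _ (hdisc.comp (comap_measurable _)) ?_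
  rintro _ ⟨A, hA, rfl⟩
  have hA' : MeasurableSet ((fun ω : G.Stacks => ω 0) ⁻¹' A) := measurable_pi_apply 0 hA
  have hev : Measurable fun ω : G.Stacks => ω 0 := measurable_pi_apply 0
  rw [← lintegral_indicator hA', ← lintegral_indicator hA',
    lintegral_stackMeasure_push Set.univ
      (F := Set.indicator _ fun ω : G.Stacks => expectedTime (ω 0)) ((hdisc.comp hev).indicator hA'),
    lintegral_stackMeasure_push Set.univ (measurable_runningTime_canonicalRule.indicator hA')]
  congr 1
  refine Finset.sum_congr rfl fun r _ => ?_
  by_cases hr : r ∈ A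
  · simp [Set.indicator, hr, lintegral_runningTime_push]
  · simp [Set.indicator, hr]

end Chain

/-! ### Signs of edges and circulation along cycles -/

section TailSign

/-- `1` if `x` is the tail of `e`, and `-1` otherwise. -/
def tailSign (e : E(G)) (x : α) (o : G.Orientation) : ℝ := if (o e).tail = x then 1 else -1

/-- Reverse the edge `e`. -/
def flip (e : E(G)) (o : G.Orientation) : G.Orientation := Function.update o e (o e).reverse

lemma flip_flip (e : E(G)) (o : G.Orientation) : flip e (flip e o) = o := by
  simp [flip]

lemma tailSign_sq (e : E(G)) (x : α) (o : G.Orientation) : tailSign e x o ^ 2 = 1 := by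
  unfold tailSign
  split_ifs <;> norm_num

lemma tailSign_eq_or (e : E(G)) (x : α) (o : G.Orientation) :
    tailSign e x o = 1 ∨ tailSign e x o = -1 := by
  unfold tailSign
  split_ifs <;> simp

lemma tailSign_flip_of_ne {e f : E(G)} (h : f ≠ e) (x : α) (o : G.Orientation) :
    tailSign f x (flip e o) = tailSign f x o := by
  simp [tailSign, flip, h]

lemma EdgeOrientation.tail_eq_iff_head_ne {e : β} {x y : α} (h : G.IsLink e x y) (hxy : x ≠ y)
    (o : G.EdgeOrientation e) : o.tail = x ↔ o.head ≠ x := by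
  obtain ⟨⟨a, b⟩, hab⟩ := o
  simp only [tail, head]
  rcases h.eq_and_eq_or_eq_and_eq hab with ⟨rfl, rfl⟩ | ⟨rfl, rfl⟩
  · simpa using hxy.symm
  · simpa using hxy.symm

lemma EdgeOrientation.tail_eq_iff_tail_ne {e : β} {x y : α} (h : G.IsLink e x y) (hxy : x ≠ y)
    (o : G.EdgeOrientation e) : o.tail = x ↔ o.tail ≠ y := by
  obtain ⟨⟨a, b⟩, hab⟩ := o
  simp only [tail]
  rcases h.eq_and_eq_or_eq_and_eq hab with ⟨rfl, rfl⟩ | ⟨rfl, rfl⟩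
  · simpa using hxy
  · simpa using hxy.symm

lemma EdgeOrientation.head_eq_iff_tail_eq {e : β} {x y : α} (h : G.IsLink e x y) (hxy : x ≠ y)
    (o : G.EdgeOrientation e) : o.head = y ↔ o.tail = x := by
  rw [tail_eq_iff_tail_ne h hxy, Ne, tail_eq_iff_head_ne h.symm hxy.symm, not_not]

lemma tailSign_flip {e : E(G)} {x y : α} (h : G.IsLink e x y) (hxy : x ≠ y) (o : G.Orientation) :
    tailSign e x (flip e o) = -tailSign e x o := by
  have := EdgeOrientation.tail_eq_iff_head_ne h hxy (o e)
  by_cases ht : (o e).tail = x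
  · simp [tailSign, flip, ht, this.1 ht]
  · simp [tailSign, flip, ht, not_not.1 (mt this.2 ht)]

lemma tailSign_neg {e : E(G)} {x y : α} (h : G.IsLink e x y) (hxy : x ≠ y) (o : G.Orientation) :
    tailSign e y o = -tailSign e x o := by
  have := EdgeOrientation.tail_eq_iff_tail_ne h hxy (o e)
  by_cases ht : (o e).tail = x
  · simp [tailSign, ht, hxy]
  · simp [tailSign, not_not.1 (mt this.2 ht), hxy.symm]

/-- Reversing an edge is an involution on orientations. This symmetry replaces independence when
signs, and products of signs of distinct edges, are shown to have mean zero. -/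
lemma sum_eq_zero_of_flip [Fintype G.Orientation] (e : E(G)) {g : G.Orientation → ℝ}
    (h : ∀ o, g (flip e o) = -g o) : ∑ o, g o = 0 := by
  have h1 : ∑ o, g (flip e o) = ∑ o, g o :=
    Equiv.sum_comp (Function.Involutive.toPerm (flip e) (flip_flip e)) g
  simp only [h, Finset.sum_neg_distrib] at h1
  linarith

lemma tailSign_resample_of_mem {e : E(G)} {S : Set E(G)} (h : e ∈ S) (x : α)
    (r o : G.Orientation) : tailSign e x (resample S r o) = tailSign e x r := by
  simp [tailSign, resample, h]

lemma tailSign_resample_of_notMem {e : E(G)} {S : Set E(G)} (h : e ∉ S) (x : α)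
    (r o : G.Orientation) : tailSign e x (resample S r o) = tailSign e x o := by
  simp [tailSign, resample, h]

lemma tailSign_of_isSink {o : G.Orientation} {x : α} (h : o.IsSink x) (e : E(G)) :
    tailSign e x o = -1 := by
  simp [tailSign, h.2 e]

/-- The circulation of an orientation along a cycle: the number of forward edges minus the number
of backward edges. -/
def circulation {n : ℕ} (v : Fin n → α) (e : Fin n → E(G)) (o : G.Orientation) : ℝ :=
  ∑ i, tailSign (e i) (v i) o

lemma abs_circulation_le {n : ℕ} (v : Fin n → α) (e : Fin n → E(G)) (o : G.Orientation) :
    |circulation v e o| ≤ n := by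
  refine (Finset.abs_sum_le_sum_abs _ _).trans (le_of_eq ?_)
  rw [Finset.sum_congr rfl (g := fun _ => 1)]
  · simp
  · intro i _
    rcases tailSign_eq_or (e i) (v i) o with h | h <;> simp [h]

lemma isCycleIn_pair {e f : E(G)} {x y : α} (he : G.IsLink e x y) (hf : G.IsLink f x y)
    (hxy : x ≠ y) (hef : e ≠ f) : G.IsCycleIn ![x, y] fun i => (![e, f] i : β) := by
  refine ⟨?_, ?_, ?_⟩
  · intro i j
    fin_cases i <;> fin_cases j <;> simp [hxy, hxy.symm]
  · intro i j
    fin_cases i <;> fin_cases j <;>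
      simp [Subtype.val_injective.ne hef, (Subtype.val_injective.ne hef).symm]
  · intro i
    fin_cases i
    · simpa using he
    · simpa using hf.symm

lemma circulation_pair {e f : E(G)} {x y : α} (hf : G.IsLink f x y) (hxy : x ≠ y) :
    circulation ![x, y] ![e, f] = tailSign e x - tailSign f x := by
  funext o
  simp [circulation, tailSign_neg hf hxy, sub_eq_add_neg]

end TailSign

lemma IsCycleIn.ne_add_one {n : ℕ} {v : Fin (n + 1) → α} {e : Fin (n + 1) → β}
    (_ : G.IsCycleIn v e) (hn : n ≠ 0) (i : Fin (n + 1)) : i ≠ i + 1 := by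
  intro h
  exact hn (Nat.succ_injective (Fin.one_eq_zero_iff.1 (left_eq_add.1 h)))

/-! ### Pop indicators and the inequalities for pop counts -/

section PopIndicator

variable [Nonempty α]

/-- The indicator function of the orientations in which `x` is popped next. -/
def popIndicator (x : α) (o : G.Orientation) : ℝ :=
  if ¬ o.IsSinkFree ∧ chosenSink o = x then 1 else 0

/-- A vertex with a loop is the tail of that loop, hence never a sink. -/
lemma popIndicator_eq_zero_of_isLoopAt {e : β} {x : α} (h : G.IsLoopAt e x) :
    popIndicator x = (0 : G.Orientation → ℝ) := by
  funext o
  simp only [popIndicator, Pi.zero_apply, ite_eq_right_iff, and_imp]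
  rintro ho rfl
  refine absurd ?_ ((isSink_chosenSink ho).2 ⟨e, h.edge_mem⟩)
  exact h.eq_of_inc (EdgeOrientation.inc_tail _) |>.symm

lemma popIndicator_nonneg (x : α) : 0 ≤ (popIndicator x : G.Orientation → ℝ) := by
  intro o
  unfold popIndicator
  split_ifs <;> simp

lemma hasSink_eq_sum_popIndicator [Finite V(G)] :
    (hasSink : G.Orientation → ℝ) = ∑ x ∈ (Set.toFinite V(G)).toFinset, popIndicator x := by
  funext o
  rw [Finset.sum_apply]
  by_cases ho : o.IsSinkFree
  · simp [hasSink, popIndicator, ho]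
  · simp [hasSink, popIndicator, ho, (isSink_chosenSink ho).1]

end PopIndicator

/-- The bounds on the expected numbers of pops `N x`, starting from `o`, on which the bound on the
running time rests. -/
structure PopBounds (o : G.Orientation) (N : α → ℝ) : Prop where
  nonneg : ∀ x, 0 ≤ N x
  link : ∀ (e : E(G)) (x y : α), G.IsLink e x y → N x ≤ N y + 2
  head : ∀ (e : E(G)) (x y : α), G.IsLink e x y → (o e).head = y → N x ≤ N y
  loop : ∀ (e : β) (x : α), G.IsLoopAt e x → N x = 0
  cycle : ∀ (n : ℕ) (v : Fin (n + 1) → α) (e : Fin (n + 1) → E(G)), n ≠ 0 →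
    G.IsCycleIn v (fun i => (e i : β)) →
    2 * ∑ i, N (v i) ≤ (n + 1 : ℝ) ^ 2 - circulation v e o ^ 2
  parallel : ∀ (e f : E(G)) (x y : α), G.IsLink e x y → G.IsLink f x y → x ≠ y → e ≠ f →
    N x ≤ 3 / 2
  triple : ∀ (e f g : E(G)) (x y : α), G.IsLink e x y → G.IsLink f x y → G.IsLink g x y →
    x ≠ y → e ≠ f → e ≠ g → f ≠ g → N x + N y ≤ 4 / 3

open Filter Topology in
-- All the bounds are closed conditions.
lemma PopBounds.of_tendsto {o : G.Orientation} {N : ℕ → α → ℝ} {M : α → ℝ}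
    (h : ∀ k, PopBounds o (N k)) (hM : ∀ x, Tendsto (fun k => N k x) atTop (𝓝 (M x))) :
    PopBounds o M where
  nonneg x := ge_of_tendsto' (hM x) fun k => (h k).nonneg x
  link e x y hl := le_of_tendsto_of_tendsto' (hM x) ((hM y).add_const 2) fun k =>
    (h k).link e x y hl
  head e x y hl ho := le_of_tendsto_of_tendsto' (hM x) (hM y) fun k => (h k).head e x y hl ho
  loop e x hl := tendsto_nhds_unique (hM x) (by simp [(h _).loop e x hl])
  cycle n v e hn hc := le_of_tendsto'
    ((tendsto_finsetSum _ fun i _ => hM (v i)).const_mul 2) fun k => (h k).cycle n v e hn hc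
  parallel e f x y he hf hxy hef := le_of_tendsto' (hM x) fun k =>
    (h k).parallel e f x y he hf hxy hef
  triple e f g x y he hf hg hxy hef heg hfg := le_of_tendsto' ((hM x).add (hM y)) fun k =>
    (h k).triple e f g x y he hf hg hxy hef heg hfg

/-! ### One-step drifts of the two functionals -/

section Increments

variable [Finite V(G)] [Finite E(G)] [Nonempty α]

lemma transition_eq_of_isSinkFree (f : G.Orientation → ℝ) {o : G.Orientation}
    (h : o.IsSinkFree) : transition f o = f o := by
  simp [transition_apply, h]

lemma transition_eq_add {f : G.Orientation → ℝ} {o : G.Orientation} (h : ¬ o.IsSinkFree)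
    {c : ℝ} {g : G.Orientation → ℝ} (hg : ∑ r, g r = 0)
    (hf : ∀ r, f (resample (G.star (chosenSink o)) r o) = c + g r) : transition f o = c := by
  have : Nonempty G.Orientation := ⟨o⟩
  have hc : (Fintype.card G.Orientation : ℝ) ≠ 0 := by exact_mod_cast Fintype.card_ne_zero
  simp only [transition_apply, h, if_false, hf, Finset.sum_add_distrib, hg, Finset.sum_const,
    Finset.card_univ, nsmul_eq_mul, add_zero]
  field_simp

/-- A pop at `x` finds the sign `-1`, a pop at `y` finds `1`; either way the new sign is centred.
Other pops do not touch `e`. -/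
lemma transition_tailSign {e : E(G)} {x y : α} (h : G.IsLink e x y) (hxy : x ≠ y) :
    transition (tailSign e x) - tailSign e x = popIndicator x - popIndicator y := by
  funext o
  simp only [Pi.sub_apply]
  by_cases ho : o.IsSinkFree
  · simp [transition_eq_of_isSinkFree _ ho, popIndicator, ho]
  have hs := isSink_chosenSink ho
  by_cases hi : e ∈ G.star (chosenSink o)
  · rw [transition_eq_add ho (c := 0) (sum_eq_zero_of_flip e (tailSign_flip h hxy))
      fun r => by rw [tailSign_resample_of_mem hi, zero_add]]
    rcases Inc.eq_or_eq_of_isLink hi h with hx | hy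
    · have : chosenSink o ≠ y := hx ▸ hxy
      simp [popIndicator, ho, hx, hxy, tailSign_of_isSink (hx ▸ hs)]
    · have := tailSign_neg h hxy o
      rw [tailSign_of_isSink (hy ▸ hs)] at this
      simp only [popIndicator, ho, hy, hxy.symm]
      norm_num
      linarith
  · have hx : chosenSink o ≠ x := fun hx => hi (hx ▸ h.inc_left)
    have hy : chosenSink o ≠ y := fun hy => hi (hy ▸ h.inc_right)
    rw [transition_eq_add ho (c := tailSign e x o) (g := 0) (by simp)
      fun r => by rw [tailSign_resample_of_notMem hi, Pi.zero_apply, add_zero]]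
    simp [popIndicator, hx, hy]

/-- At a sink on the cycle, the incoming cycle edge has sign `1` and the outgoing one `-1`. These
cancel and are replaced by two independent centred signs, each of variance `1`. A loop must be
excluded, as its sign is constant. -/
lemma transition_circulation_sq {n : ℕ} (hn : n ≠ 0) {v : Fin (n + 1) → α}
    {e : Fin (n + 1) → E(G)} (h : G.IsCycleIn v fun i => (e i : β)) :
    transition (circulation v e ^ 2) - circulation v e ^ 2 =
      (2 : ℝ) • ∑ i, popIndicator (v i) := by
  funext o
  simp only [Pi.sub_apply, Pi.pow_apply, Pi.smul_apply, Finset.sum_apply, smul_eq_mul]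
  by_cases ho : o.IsSinkFree
  · simp [transition_eq_of_isSinkFree _ ho, popIndicator, ho]
  have hs := isSink_chosenSink ho
  set S := G.star (chosenSink o) with hS
  have hmem (k : Fin (n + 1)) (hk : e k ∈ S) : chosenSink o = v k ∨ chosenSink o = v (k + 1) :=
    Inc.eq_or_eq_of_isLink hk (h.isLink k)
  by_cases hv : ∃ j, v j = chosenSink o
  swap
  · push Not at hv
    rw [transition_eq_add ho (c := circulation v e o ^ 2) (g := 0) (by simp)]
    · simp [popIndicator, fun i => (hv i).symm]
    · intro r
      have : circulation v e (resample S r o) = circulation v e o := by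
        refine Finset.sum_congr rfl fun k _ => tailSign_resample_of_notMem (fun hk => ?_) _ _ _
        rcases hmem k hk with hk | hk <;> exact hv _ hk.symm
      simp [← hS, this]
  obtain ⟨j, hj⟩ := hv
  -- With this indexing, the cycle edges at the popped vertex are `e i` and `e (i + 1)`.
  obtain ⟨i, rfl⟩ : ∃ i, j = i + 1 := ⟨j - 1, by simp⟩
  have hi : i ≠ i + 1 := h.ne_add_one hn i
  have hvi : v i ≠ v (i + 1) := h.vertex_injective.ne hi
  have hvi' : v (i + 1) ≠ v (i + 1 + 1) := h.vertex_injective.ne (h.ne_add_one hn _)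
  have hei : e i ≠ e (i + 1) := fun he => hi (h.edge_injective (congrArg Subtype.val he))
  have hS₁ : e i ∈ S := by
    rw [hS, ← hj]
    exact (h.isLink i).inc_right
  have hS₂ : e (i + 1) ∈ S := by
    rw [hS, ← hj]
    exact (h.isLink (i + 1)).inc_left
  rw [← hj] at hs
  have hcirc (r : G.Orientation) : circulation v e (resample S r o) =
      circulation v e o + tailSign (e i) (v i) r + tailSign (e (i + 1)) (v (i + 1)) r := by
    have h₁ : circulation v e (resample S r o) - circulation v e o =
        (tailSign (e i) (v i) (resample S r o) - tailSign (e i) (v i) o) +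
        (tailSign (e (i + 1)) (v (i + 1)) (resample S r o) -
          tailSign (e (i + 1)) (v (i + 1)) o) := by
      rw [circulation, circulation, ← Finset.sum_sub_distrib]
      refine Finset.sum_eq_add i (i + 1) hi (fun k _ hk => ?_) (by simp) (by simp)
      rw [tailSign_resample_of_notMem, sub_self]
      intro hk'
      rcases hmem k hk' with hk' | hk' <;> rw [← hj] at hk'
      · exact hk.2 (h.vertex_injective hk').symm
      · exact hk.1 (add_right_cancel (h.vertex_injective hk')).symm
    have h₂ : tailSign (e i) (v i) o = 1 := by
      have := tailSign_neg (h.isLink i) hvi o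
      rw [tailSign_of_isSink hs] at this
      linarith
    rw [tailSign_resample_of_mem hS₁, tailSign_resample_of_mem hS₂, h₂,
      tailSign_of_isSink hs] at h₁
    linarith
  have hind : ∑ k, popIndicator (v k) o = 1 := by
    rw [Finset.sum_eq_single (i + 1)]
    · simp [popIndicator, ho, hj]
    · intro k _ hk
      simp [popIndicator, ← hj, h.vertex_injective.eq_iff, hk.symm]
    · simp
  -- The mean-zero part `g` consists of the cross terms in the square of the circulation plus two
  -- signs; the squares of the two signs give the `2`.
  rw [hind, transition_eq_add ho (c := circulation v e o ^ 2 + 2)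
    (g := fun r => 2 * circulation v e o * tailSign (e i) (v i) r +
      2 * circulation v e o * tailSign (e (i + 1)) (v (i + 1)) r +
      2 * (tailSign (e i) (v i) r * tailSign (e (i + 1)) (v (i + 1)) r))]
  · ring
  · rw [Finset.sum_add_distrib, Finset.sum_add_distrib, ← Finset.mul_sum, ← Finset.mul_sum,
      ← Finset.mul_sum, sum_eq_zero_of_flip (e i) (tailSign_flip (h.isLink i) hvi),
      sum_eq_zero_of_flip (e (i + 1)) (tailSign_flip (h.isLink (i + 1)) hvi'),
      sum_eq_zero_of_flip (e i) fun r => by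
        rw [tailSign_flip (h.isLink i) hvi, tailSign_flip_of_ne hei.symm, neg_mul]]
    simp
  · intro r
    rw [Pi.pow_apply, ← hS, hcirc]
    have h₁ := tailSign_sq (e i) (v i) r
    have h₂ := tailSign_sq (e (i + 1)) (v (i + 1)) r
    linear_combination h₁ + h₂

end Increments

/-! ### Bounds on the expected pops up to a finite time -/

section ExpectedPops

variable [Finite V(G)] [Finite E(G)] [Nonempty α]

/-- The expected number of times that `x` is popped in the first `k` steps, starting from `o`. -/
def expectedPops (o : G.Orientation) (k : ℕ) (x : α) : ℝ :=
  ∑ j ∈ Finset.range k, (transition ^ j) (popIndicator x) o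

lemma expectedPops_nonneg (o : G.Orientation) (k : ℕ) (x : α) : 0 ≤ expectedPops o k x :=
  Finset.sum_nonneg fun j _ => transition_pow_nonneg (popIndicator_nonneg x) j o

lemma expectedPops_sub {e : E(G)} {x y : α} (h : G.IsLink e x y) (hxy : x ≠ y)
    (o : G.Orientation) (k : ℕ) :
    expectedPops o k x - expectedPops o k y =
      (transition ^ k) (tailSign e x) o - tailSign e x o := by
  simp only [transition_pow_sub, transition_tailSign h hxy, map_sub, Pi.sub_apply,
    Finset.sum_sub_distrib, expectedPops]

lemma two_mul_sum_expectedPops {n : ℕ} (hn : n ≠ 0) {v : Fin (n + 1) → α}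
    {e : Fin (n + 1) → E(G)} (h : G.IsCycleIn v fun i => (e i : β)) (o : G.Orientation) (k : ℕ) :
    2 * ∑ i, expectedPops o k (v i) =
      (transition ^ k) (circulation v e ^ 2) o - circulation v e o ^ 2 := by
  have := transition_pow_sub (circulation v e ^ 2) k o
  rw [Pi.pow_apply] at this
  rw [this, transition_circulation_sq hn h]
  simp only [map_smul, map_sum, Pi.smul_apply, Finset.sum_apply, smul_eq_mul, expectedPops,
    ← Finset.mul_sum]
  rw [Finset.sum_comm]

lemma two_mul_expectedPops_add {e f : E(G)} {x y : α} (he : G.IsLink e x y) (hf : G.IsLink f x y)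
    (hxy : x ≠ y) (hef : e ≠ f) (o : G.Orientation) (k : ℕ) :
    2 * (expectedPops o k x + expectedPops o k y) =
      (transition ^ k) ((tailSign e x - tailSign f x) ^ 2) o -
        (tailSign e x o - tailSign f x o) ^ 2 := by
  have := two_mul_sum_expectedPops one_ne_zero (isCycleIn_pair he hf hxy hef) o k
  rw [circulation_pair hf hxy] at this
  simpa using this

/-- Let `a` and `b` be the signs of `e` and `f` at `x`. Adding the circulation identity and both
sign identities shows that four times the expected pops of `x` is the change of `(a - b)² + a + b`.
This takes the values `-2`, `2`, `4`, so the change is at most `6`. -/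
lemma expectedPops_le_of_parallel {e f : E(G)} {x y : α} (he : G.IsLink e x y)
    (hf : G.IsLink f x y) (hxy : x ≠ y) (hef : e ≠ f) (o : G.Orientation) (k : ℕ) :
    expectedPops o k x ≤ 3 / 2 := by
  have h₁ := two_mul_expectedPops_add he hf hxy hef o k
  have h₂ := expectedPops_sub he hxy o k
  have h₃ := expectedPops_sub hf hxy o k
  have h₄ := transition_pow_le_const (c := 4)
    (f := (tailSign e x - tailSign f x) ^ 2 + tailSign e x + tailSign f x) (fun o => by
      rcases tailSign_eq_or e x o with h | h <;> rcases tailSign_eq_or f x o with h' | h' <;>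
        simp only [Pi.add_apply, Pi.pow_apply, Pi.sub_apply, h, h'] <;> norm_num) k o
  simp only [map_add, Pi.add_apply] at h₄
  have h₅ : -2 ≤ (tailSign e x o - tailSign f x o) ^ 2 + tailSign e x o + tailSign f x o := by
    rcases tailSign_eq_or e x o with h | h <;> rcases tailSign_eq_or f x o with h' | h' <;>
      rw [h, h'] <;> norm_num
  linarith

/-- Among three signs at most two pairs disagree, so the three squared differences sum to at most
`8`, while the three circulation identities add up to six times the left-hand side. -/
lemma expectedPops_add_le_of_triple {e f g : E(G)} {x y : α} (he : G.IsLink e x y)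
    (hf : G.IsLink f x y) (hg : G.IsLink g x y) (hxy : x ≠ y) (hef : e ≠ f) (heg : e ≠ g)
    (hfg : f ≠ g) (o : G.Orientation) (k : ℕ) :
    expectedPops o k x + expectedPops o k y ≤ 4 / 3 := by
  have h₁ := two_mul_expectedPops_add he hf hxy hef o k
  have h₂ := two_mul_expectedPops_add he hg hxy heg o k
  have h₃ := two_mul_expectedPops_add hf hg hxy hfg o k
  have h₄ := transition_pow_le_const (c := 8)
    (f := (tailSign e x - tailSign f x) ^ 2 + (tailSign e x - tailSign g x) ^ 2 +
      (tailSign f x - tailSign g x) ^ 2) (fun o => by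
      rcases tailSign_eq_or e x o with h | h <;> rcases tailSign_eq_or f x o with h' | h' <;>
        rcases tailSign_eq_or g x o with h'' | h'' <;>
        simp only [Pi.add_apply, Pi.pow_apply, Pi.sub_apply, h, h', h''] <;> norm_num) k o
  simp only [map_add, Pi.add_apply] at h₄
  have h₅ := sq_nonneg (tailSign e x o - tailSign f x o)
  have h₆ := sq_nonneg (tailSign e x o - tailSign g x o)
  have h₇ := sq_nonneg (tailSign f x o - tailSign g x o)
  linarith

lemma popBounds_expectedPops (o : G.Orientation) (k : ℕ) : PopBounds o (expectedPops o k) where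
  nonneg := expectedPops_nonneg o k
  link e x y h := by
    rcases eq_or_ne x y with rfl | hxy
    · linarith
    have h₁ := expectedPops_sub h hxy o k
    have h₂ := transition_pow_le_const (f := tailSign e x) (c := 1)
      (fun o => by rcases tailSign_eq_or e x o with h | h <;> rw [h]; norm_num) k o
    rcases tailSign_eq_or e x o with h' | h' <;> linarith
  head e x y h ho := by
    rcases eq_or_ne x y with rfl | hxy
    · exact le_rfl
    have h₁ := expectedPops_sub h hxy o k
    have h₂ := transition_pow_le_const (f := tailSign e x) (c := 1)
      (fun o => by rcases tailSign_eq_or e x o with h | h <;> rw [h]; norm_num) k o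
    have h₃ : tailSign e x o = 1 := by
      simp [tailSign, (EdgeOrientation.head_eq_iff_tail_eq h hxy (o e)).1 ho]
    linarith
  loop e x h := by simp [expectedPops, popIndicator_eq_zero_of_isLoopAt h]
  cycle n v e hn h := by
    rw [two_mul_sum_expectedPops hn h]
    refine sub_le_sub_right (transition_pow_le_const (fun o => ?_) k o) _
    rw [Pi.pow_apply, ← sq_abs]
    have := abs_circulation_le v e o
    push_cast at this
    gcongr
  parallel e f x y he hf hxy hef := expectedPops_le_of_parallel he hf hxy hef o k
  triple e f g x y he hf hg hxy hef heg hfg :=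
    expectedPops_add_le_of_triple he hf hg hxy hef heg hfg o k

end ExpectedPops

/-! ### Exploration of the graph: from the inequalities to `n (n - 1)` -/

/-- `S` consists of the vertices of a path `v 0, …, v k` of `G` with a self-loop at `v k`, and the
values of `N` along the path are `2 k, 2 (k - 1), …, 0`. -/
def IsTightPath (G : Graph α β) (N : α → ℝ) (S : Finset α) : Prop :=
  ∃ (k : ℕ) (v : Fin (k + 1) → α), Function.Injective v ∧ (∀ x, x ∈ S ↔ ∃ i, v i = x) ∧
    (∀ i : Fin k, G.Adj (v i.castSucc) (v i.succ)) ∧ (∀ i, N (v i) = 2 * ((k : ℝ) - (i : ℕ))) ∧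
    ∃ e, G.IsLoopAt e (v (Fin.last k))

/-- `S` consists of two vertices of `G` which are joined by two parallel edges. -/
def IsParallelPair (G : Graph α β) (S : Finset α) : Prop :=
  ∃ (x y : α) (e f : E(G)), x ≠ y ∧ S = {x, y} ∧ e ≠ f ∧ G.IsLink e x y ∧ G.IsLink f x y

/-- The invariant of the exploration of the graph, one vertex or one cycle at a time. -/
structure IsBounded (G : Graph α β) (N : α → ℝ) (S : Finset α) : Prop where
  nonempty : S.Nonempty
  subset : ∀ x ∈ S, x ∈ V(G)
  sum_le : ∑ x ∈ S, N x ≤ S.card * (S.card - 1 : ℝ)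
  le : ∀ x ∈ S, N x ≤ 2 * (S.card - 1 : ℝ)
  tight : ∑ x ∈ S, N x = S.card * (S.card - 1 : ℝ) → IsTightPath G N S ∨ IsParallelPair G S

variable {o : G.Orientation} {N : α → ℝ}

lemma PopBounds.adj_le (h : PopBounds o N) {x y : α} (hxy : G.Adj x y) : N x ≤ N y + 2 := by
  obtain ⟨e, he⟩ := hxy
  exact h.link ⟨e, he.edge_mem⟩ x y he

lemma IsBounded.insert_of_adj (h : PopBounds o N) {S : Finset α} (hS : IsBounded G N S) {x y : α}
    (hx : x ∉ S) (hy : y ∈ S) (hxy : G.Adj x y) : IsBounded G N (insert x S) := by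
  have hle := h.adj_le hxy
  have hNy := hS.le y hy
  have hsum := hS.sum_le
  have hcard : (((insert x S).card : ℕ) : ℝ) = S.card + 1 := by
    rw [Finset.card_insert_of_notMem hx]
    push_cast
    ring
  refine ⟨Finset.insert_nonempty _ _, ?_, ?_, ?_, ?_⟩
  · intro z hz
    rcases Finset.mem_insert.1 hz with rfl | hz
    · exact hxy.left_mem
    · exact hS.subset z hz
  · rw [Finset.sum_insert hx, hcard]
    linarith
  · intro z hz
    rw [hcard]
    rcases Finset.mem_insert.1 hz with rfl | hz
    · linarith
    · linarith [hS.le z hz]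
  · intro heq
    left
    rw [Finset.sum_insert hx, hcard] at heq
    have hNx : N x = 2 * S.card := by linarith
    have hNy' : N y = 2 * (S.card - 1 : ℝ) := by linarith
    rcases hS.tight (by linarith) with ⟨k, v, hv, hmem, hadj, hval, hloop⟩ | hp
    · have hk : S.card = k + 1 := by
        rw [show S = Finset.univ.image v by ext z; simp [hmem], Finset.card_image_of_injective _ hv]
        simp
      -- Along a tight path the value `2 (S.card - 1) = 2 k` occurs only at the free end, so the new
      -- vertex extends the path there.
      have hy0 : y = v 0 := by
        obtain ⟨i, rfl⟩ := (hmem y).1 hy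
        rw [hval, hk] at hNy'
        push_cast at hNy'
        have : ((i : ℕ) : ℝ) = 0 := by linarith
        rw [show i = 0 by exact_mod_cast this]
      refine ⟨k + 1, Fin.cons x v, ?_, ?_, ?_, ?_, ?_⟩
      · refine Fin.cons_injective_iff.2 ⟨?_, hv⟩
        rintro ⟨i, hi⟩
        exact hx ((hmem x).2 ⟨i, hi⟩)
      · intro z
        rw [Finset.mem_insert, hmem,
          Fin.exists_fin_succ (P := fun i => (Fin.cons x v : Fin (k + 2) → α) i = z)]
        simp [eq_comm]
      · intro i
        refine Fin.cases ?_ (fun j => ?_) i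
        · simpa [← hy0] using hxy
        · simpa [← Fin.succ_castSucc] using hadj j
      · intro i
        refine Fin.cases ?_ (fun j => ?_) i
        · simp [hNx, hk]
        · simp [hval]
      · simpa [← Fin.succ_last] using hloop
    -- A parallel pair cannot be extended tightly: `N y` would be `2`, above the bound `3 / 2`.
    · obtain ⟨a, b, e, f, hab, rfl, hef, he, hf⟩ := hp
      have hc : ((({a, b} : Finset α).card : ℕ) : ℝ) = 2 := by
        rw [Finset.card_pair hab]
        norm_num
      rw [hc] at hNy'
      have h₁ := h.parallel e f a b he hf hab hef
      have h₂ := h.parallel e f b a he.symm hf.symm hab.symm hef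
      simp only [Finset.mem_insert, Finset.mem_singleton] at hy
      rcases hy with rfl | rfl <;> linarith

/-- The two sums leave a slack of `2 * S.card * T.card`, so a union is never tight. -/
lemma IsBounded.union {S T : Finset α} (hS : IsBounded G N S) (hT : IsBounded G N T)
    (hST : Disjoint S T) : IsBounded G N (S ∪ T) := by
  have h₁ : (1 : ℝ) ≤ S.card := by exact_mod_cast hS.nonempty.card_pos
  have h₂ : (1 : ℝ) ≤ T.card := by exact_mod_cast hT.nonempty.card_pos
  have hcard : (((S ∪ T).card : ℕ) : ℝ) = S.card + T.card := by
    rw [Finset.card_union_of_disjoint hST]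
    push_cast
    ring
  have hlt : ∑ x ∈ S ∪ T, N x < (S ∪ T).card * ((S ∪ T).card - 1 : ℝ) := by
    rw [Finset.sum_union hST, hcard]
    nlinarith [hS.sum_le, hT.sum_le]
  refine ⟨hS.nonempty.mono Finset.subset_union_left, ?_, hlt.le, ?_, fun h => absurd h hlt.ne⟩
  · intro x hx
    exact (Finset.mem_union.1 hx).elim (hS.subset x) (hT.subset x)
  · intro x hx
    rw [hcard]
    rcases Finset.mem_union.1 hx with hx | hx
    · linarith [hS.le x hx]
    · linarith [hT.le x hx]

/-- Since `N` drops by at most `2` per edge, a large value at `v i` forces a large sum around the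
cycle. With `m = n + 1`, summing gives `m * N (v i) - m (m - 1) ≤ m² / 2`. -/
lemma PopBounds.le_of_isCycleIn (h : PopBounds o N) {n : ℕ} (hn : n ≠ 0) {v : Fin (n + 1) → α}
    {e : Fin (n + 1) → β} (hc : G.IsCycleIn v e) :
    2 * ∑ i, N (v i) ≤ (n + 1 : ℝ) ^ 2 ∧ ∀ i, N (v i) ≤ 3 / 2 * (n + 1 : ℝ) - 1 := by
  have hsum : 2 * ∑ i, N (v i) ≤ (n + 1 : ℝ) ^ 2 := by
    have := h.cycle n v (fun i => ⟨e i, (hc.isLink i).edge_mem⟩) hn hc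
    nlinarith [sq_nonneg (circulation v (fun i => ⟨e i, (hc.isLink i).edge_mem⟩) o)]
  refine ⟨hsum, fun i => ?_⟩
  have hstep (j : Fin (n + 1)) : N (v i) - 2 * (j : ℕ) ≤ N (v (i + j)) := by
    induction j using Fin.induction with
    | zero => simp
    | succ j ih =>
      have := h.adj_le (hc.isLink (i + j.castSucc)).adj
      rw [add_assoc, Fin.coeSucc_eq_succ] at this
      simp only [Fin.val_succ, Fin.val_castSucc] at ih ⊢
      push_cast
      linarith
  have htot := Finset.sum_le_sum fun j (_ : j ∈ Finset.univ) => hstep j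
  have hrot : ∑ j, N (v (i + j)) = ∑ j, N (v j) :=
    Equiv.sum_comp (Equiv.addLeft i) (fun j => N (v j))
  rw [hrot, Finset.sum_sub_distrib,
    ← Finset.mul_sum, Fin.sum_univ_eq_sum_range (fun j => (j : ℝ)), ← Nat.cast_sum] at htot
  have hgauss := Finset.sum_range_id_mul_two (n + 1)
  rw [Nat.add_sub_cancel] at hgauss
  have hgauss' : ((∑ j ∈ Finset.range (n + 1), j : ℕ) : ℝ) * 2 = (n + 1) * n := by
    exact_mod_cast hgauss
  simp only [Finset.sum_const, Finset.card_univ, Fintype.card_fin, nsmul_eq_mul] at htot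
  push_cast at htot hgauss'
  have hpos : (0 : ℝ) < n + 1 := by positivity
  have : (n + 1 : ℝ) * N (v i) ≤ (n + 1) * (3 / 2 * (n + 1 : ℝ) - 1) := by nlinarith
  exact le_of_mul_le_mul_left this hpos

/-- For length `m ≥ 2`, `m² / 2 ≤ m (m - 1)` with equality only for `m = 2`, and `3 m / 2 - 1 ≤ 2 (m
- 1)`. A loop is a tight path with one vertex. -/
lemma PopBounds.isBounded_of_isCycleIn (h : PopBounds o N) {n : ℕ} {v : Fin (n + 1) → α}
    {e : Fin (n + 1) → β} (hc : G.IsCycleIn v e) : IsBounded G N (Finset.univ.image v) := by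
  have hcard : (((Finset.univ.image v).card : ℕ) : ℝ) = n + 1 := by
    rw [Finset.card_image_of_injective _ hc.vertex_injective]
    simp
  have hsum : ∑ x ∈ Finset.univ.image v, N x = ∑ i, N (v i) :=
    Finset.sum_image hc.vertex_injective.injOn
  refine ⟨by simp, ?_, ?_, ?_, ?_⟩
  · intro x hx
    obtain ⟨i, -, rfl⟩ := Finset.mem_image.1 hx
    exact (hc.isLink i).left_mem
  all_goals rw [hcard]
  all_goals rcases Nat.eq_zero_or_pos n with rfl | hn
  · have : N (v 0) = 0 := h.loop (e 0) _ (hc.isLink 0)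
    simp [this]
  · rw [hsum]
    have h₁ := (h.le_of_isCycleIn hn.ne' hc).1
    have : (1 : ℝ) ≤ n := by exact_mod_cast hn
    nlinarith
  · have : N (v 0) = 0 := h.loop (e 0) _ (hc.isLink 0)
    simp [this]
  · intro x hx
    obtain ⟨i, -, rfl⟩ := Finset.mem_image.1 hx
    have h₁ := (h.le_of_isCycleIn hn.ne' hc).2 i
    have : (1 : ℝ) ≤ n := by exact_mod_cast hn
    linarith
  · intro _
    left
    refine ⟨0, v, hc.vertex_injective, by simp [eq_comm], fun i => i.elim0, fun i => ?_, e 0, hc.isLink 0⟩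
    have : N (v 0) = 0 := h.loop (e 0) _ (hc.isLink 0)
    rw [Fin.fin_one_eq_zero i]
    simp [this]
  · intro heq
    right
    rw [hsum] at heq
    have h₁ := (h.le_of_isCycleIn hn.ne' hc).1
    have h₂ : (n : ℝ) ≤ 1 := by
      have : (1 : ℝ) ≤ n := by exact_mod_cast hn
      nlinarith
    obtain rfl : n = 1 := le_antisymm (by exact_mod_cast h₂) hn
    refine ⟨v 0, v 1, ⟨e 0, (hc.isLink 0).edge_mem⟩, ⟨e 1, (hc.isLink 1).edge_mem⟩,
      hc.vertex_injective.ne (by simp), ?_, ?_, hc.isLink 0, (hc.isLink 1).symm⟩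
    · ext x
      simp [Fin.exists_fin_two, eq_comm]
    · intro h
      exact absurd (hc.edge_injective (congrArg Subtype.val h)) (by simp)

/-- A component without cycles would be a tree, and a cycle of the component is a cycle of `G`. -/
lemma NoTreeComponent.exists_isCycleIn (h : G.NoTreeComponent) {x : α} (hx : x ∈ V(G)) :
    ∃ (n : ℕ) (v : Fin (n + 1) → α) (e : Fin (n + 1) → β),
      G.IsCycleIn v e ∧ ∀ i, Relation.ReflTransGen G.Adj x (v i) := by
  by_contra hcon
  push Not at hcon
  have hlift (y : α) (hy : Relation.ReflTransGen G.Adj x y) :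
      Relation.ReflTransGen (G.component x).Adj x y := by
    induction hy with
    | refl => exact .refl
    | @tail b c hb hbc ih =>
      obtain ⟨e, he⟩ := hbc
      exact ih.tail ⟨e, he, hb, hb.tail ⟨e, he⟩⟩
  have hsymm : Std.Symm (G.component x).Adj := ⟨fun _ _ h => h.symm⟩
  refine h x hx ⟨⟨x, .refl⟩, fun y hy z hz => ?_, fun n v e hc => ?_⟩
  · exact (Relation.ReflTransGen.stdSymm.symm _ _ (hlift y hy)).trans (hlift z hz)
  · obtain ⟨i, hi⟩ := hcon n v e
      ⟨hc.vertex_injective, hc.edge_injective, fun i => (hc.isLink i).1⟩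
    exact hi (hc.isLink i).2.1

lemma PopBounds.isBounded [Finite V(G)] (h : PopBounds o N) (hne : V(G).Nonempty)
    (htree : G.NoTreeComponent) : IsBounded G N (Set.toFinite V(G)).toFinset := by
  set V := (Set.toFinite V(G)).toFinset with hV
  have hVmem (x : α) : x ∈ V ↔ x ∈ V(G) := by simp [hV]
  let F := V.powerset.filter (IsBounded G N)
  have hmemF (S : Finset α) : S ∈ F ↔ IsBounded G N S := by
    simp only [F, Finset.mem_filter, Finset.mem_powerset, and_iff_right_iff_imp]
    intro hS x hx
    exact (hVmem x).2 (hS.subset x hx)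
  have hF : F.Nonempty := by
    obtain ⟨x, hx⟩ := hne
    obtain ⟨n, v, e, hc, -⟩ := htree.exists_isCycleIn hx
    exact ⟨_, (hmemF _).2 (h.isBounded_of_isCycleIn hc)⟩
  -- A largest bounded set is closed under adjacency. If it missed a vertex, a cycle in the
  -- component of that vertex would be disjoint from it and could be united with it.
  obtain ⟨S, hSF, hmax⟩ := Finset.exists_max_image F Finset.card hF
  have hS := (hmemF S).1 hSF
  have hclosed : ∀ x y, x ∉ S → G.Adj x y → y ∉ S := by
    intro x y hx hxy hy
    have := hmax _ ((hmemF _).2 (hS.insert_of_adj h hx hy hxy))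
    rw [Finset.card_insert_of_notMem hx] at this
    omega
  have hSV : S = V := by
    refine Finset.Subset.antisymm (fun x hx => (hVmem x).2 (hS.subset x hx)) fun x hx => ?_
    by_contra hxS
    obtain ⟨n, v, e, hc, hreach⟩ := htree.exists_isCycleIn ((hVmem x).1 hx)
    have hdisj : Disjoint S (Finset.univ.image v) := by
      rw [Finset.disjoint_right]
      intro z hz
      obtain ⟨i, -, rfl⟩ := Finset.mem_image.1 hz
      have hr := hreach i
      generalize v i = z at hr
      induction hr with
      | refl => exact hxS
      | tail _ hbc ih => exact hclosed _ _ ih hbc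
    have := hmax _ ((hmemF _).2 (hS.union (h.isBounded_of_isCycleIn hc) hdisj))
    rw [Finset.card_union_of_disjoint hdisj] at this
    have hpos : 0 < (Finset.univ.image v).card := Finset.card_pos.2 (by simp)
    omega
  rwa [← hSV]

/-! ### Rigidity in the case of equality -/

lemma card_toFinset_vertexSet [Finite V(G)] :
    (Set.toFinite V(G)).toFinset.card = V(G).ncard :=
  (Set.ncard_eq_toFinset_card _ _).symm

lemma PopBounds.isNLollipop [Finite V(G)] (h : PopBounds o N)
    (hloop : ∀ x, (G.loopSet x).Subsingleton)
    (hp : IsTightPath G N (Set.toFinite V(G)).toFinset) :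
    G.IsNLollipop V(G).ncard ∧ ∃ σ : G.Orientation, σ.IsSinkFree ∧ o = σ.reverse := by
  obtain ⟨k, v, hv, hmem, hadj, hval, e₀, he₀⟩ := hp
  choose e he using hadj
  simp only [Set.Finite.mem_toFinset] at hmem
  have hstep (i : Fin k) : N (v i.castSucc) = N (v i.succ) + 2 := by
    rw [hval, hval]
    simp
    ring
  have hpos (i : Fin k) : 2 ≤ N (v i.castSucc) := by
    rw [hstep]
    linarith [h.nonneg (v i.succ)]
  have hlast (i : Fin (k + 1)) (hi : N (v i) = 0) : i = Fin.last k := by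
    rw [hval] at hi
    refine Fin.ext ?_
    have : ((i : ℕ) : ℝ) = k := by linarith
    exact_mod_cast this
  let e' : Fin (k + 1) → β := Fin.snoc (α := fun _ => β) e e₀
  have he' (i : Fin k) : e' i.castSucc = e i := by simp [e']
  have he'₀ : e' (Fin.last k) = e₀ := by simp [e']
  have hinc (i : Fin (k + 1)) : G.Inc (e' i) (v i) := by
    refine Fin.lastCases ?_ (fun j => ?_) i
    · rw [he'₀]
      exact he₀.inc
    · rw [he']
      exact (he j).inc_left
  have hge (i j : Fin (k + 1)) (hij : G.Inc (e' i) (v j)) : i ≤ j := by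
    revert hij
    refine Fin.lastCases ?_ (fun i => ?_) i
    · rw [he'₀]
      intro hij
      rw [hv (he₀.eq_of_inc hij)]
    · rw [he']
      intro hij
      rcases hij.eq_or_eq_of_isLink (he i) with hij | hij
      · rw [hv hij]
      · rw [hv hij]
        exact i.castSucc_lt_succ.le
  -- There are no further edges: a loop forces `N = 0`, hence the last vertex; a chord would change
  -- `N` by more than `2`; an edge parallel to a path edge would give `N ≤ 3 / 2` where `N ≥ 2`.
  have hedge (f : β) (i j : Fin (k + 1)) (hf : G.IsLink f (v i) (v j)) (hij : i ≤ j) :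
      ∃ i, e' i = f := by
    rcases hij.eq_or_lt with rfl | hlt
    · obtain rfl := hlast i (h.loop f _ hf)
      exact ⟨Fin.last k, he'₀ ▸ hloop _ he₀ hf⟩
    · obtain ⟨i, rfl⟩ := Fin.exists_castSucc_eq.2 (hlt.trans_le (Fin.le_last j)).ne
      have hle := h.adj_le hf.adj
      rw [hval, hval] at hle
      have hle' : ((j : ℕ) : ℝ) ≤ (i : ℕ) + 1 := by
        simp only [Fin.val_castSucc] at hle
        linarith
      have hj : j = i.succ := by
        have h₁ : (j : ℕ) ≤ i + 1 := by exact_mod_cast hle'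
        have h₂ : (i : ℕ) < j := hlt
        exact Fin.ext (by rw [Fin.val_succ]; omega)
      subst hj
      refine ⟨i.castSucc, ?_⟩
      rw [he']
      by_contra hne
      have := h.parallel ⟨f, hf.edge_mem⟩ ⟨e i, (he i).edge_mem⟩ _ _ hf (he i) (hv.ne hlt.ne)
        fun heq => hne (congrArg Subtype.val heq).symm
      linarith [hpos i]
  have hrange : Set.range v = V(G) := by
    ext x
    exact (hmem x).symm
  -- An edge initially pointing towards the loop would not let `N` drop along it.
  have hhead (i : Fin k) : (o ⟨e i, (he i).edge_mem⟩).head = v i.castSucc := by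
    refine (Inc.eq_or_eq_of_isLink (o ⟨e i, (he i).edge_mem⟩).inc_head (he i)).resolve_right ?_
    intro hh
    have := h.head _ _ _ (he i) hh
    linarith [hstep i]
  refine ⟨⟨k, v, e', ?_, hv, ?_, hrange, ?_, ?_, ?_⟩, o.reverse, ?_, rfl⟩
  · rw [← hrange, Set.ncard_range_of_injective hv]
    simp
  · intro i j hij
    exact le_antisymm (hge i j (hij ▸ hinc j)) (hge j i (hij ▸ hinc i))
  · ext f
    constructor
    · rintro ⟨i, rfl⟩
      exact (hinc i).edge_mem
    · intro hf
      obtain ⟨x, y, hxy⟩ := G.exists_isLink_of_mem_edgeSet hf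
      obtain ⟨i, rfl⟩ := (hmem x).1 hxy.left_mem
      obtain ⟨j, rfl⟩ := (hmem y).1 hxy.right_mem
      rcases le_total i j with hij | hij
      · exact hedge f i j hxy hij
      · exact hedge f j i hxy.symm hij
  · intro i
    rw [he']
    exact he i
  · rw [he'₀]
    exact he₀
  · intro x hx
    obtain ⟨i, rfl⟩ := (hmem x).1 hx.1
    revert hx
    refine Fin.lastCases ?_ (fun i => ?_) i
    · intro hx
      exact hx.2 ⟨e₀, he₀.edge_mem⟩ (he₀.eq_of_inc (EdgeOrientation.inc_tail _)).symm
    · intro hx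
      exact hx.2 ⟨e i, (he i).edge_mem⟩ (hhead i)

/-- The two values sum to `2` and are at most `3 / 2`, so both are positive and there is no loop. A
third parallel edge would bound the sum by `4 / 3`. Equality in the cycle bound makes the initial
circulation vanish. -/
lemma PopBounds.isNCycle_two [Finite V(G)] (h : PopBounds o N)
    (hsum : ∑ x ∈ (Set.toFinite V(G)).toFinset, N x =
      (V(G).ncard : ℝ) * ((V(G).ncard : ℝ) - 1))
    (hp : IsParallelPair G (Set.toFinite V(G)).toFinset) :
    V(G).ncard = 2 ∧ G.IsNCycle 2 ∧ ∃ x, ∀ e, (o e).head = x := by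
  obtain ⟨x, y, e, f, hxy, hV, hef, he, hf⟩ := hp
  have hcard : V(G).ncard = 2 := by rw [← card_toFinset_vertexSet, hV, Finset.card_pair hxy]
  rw [hcard, hV, Finset.sum_pair hxy] at hsum
  norm_num at hsum
  have hmem (z : α) : z ∈ V(G) ↔ z = x ∨ z = y := by
    rw [← Set.Finite.mem_toFinset (Set.toFinite V(G)), hV]
    simp
  have hx := h.parallel e f x y he hf hxy hef
  have hy := h.parallel e f y x he.symm hf.symm hxy.symm hef
  have hedge (g : E(G)) : g = e ∨ g = f := by
    have hlink : G.IsLink g x y := by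
      obtain ⟨a, b, hab⟩ := G.exists_isLink_of_mem_edgeSet g.2
      have hnl : a ≠ b := by
        rintro rfl
        have h0 := h.loop g a hab
        rcases (hmem a).1 hab.left_mem with rfl | rfl <;> linarith
      rcases (hmem a).1 hab.left_mem with rfl | rfl <;>
        rcases (hmem b).1 hab.right_mem with rfl | rfl
      · exact absurd rfl hnl
      · exact hab
      · exact hab.symm
      · exact absurd rfl hnl
    by_contra hne
    push Not at hne
    have := h.triple g e f x y hlink he hf hxy hne.1 hne.2 hef
    linarith
  have hcyc := isCycleIn_pair he hf hxy hef
  refine ⟨hcard, ⟨1, ![x, y], fun i => ![e, f] i, rfl, hcyc, ?_, ?_⟩, ?_⟩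
  · ext z
    simp [hmem, eq_comm, or_comm]
  · ext g
    constructor
    · rintro ⟨i, rfl⟩
      exact (![e, f] i).2
    · intro hg
      rcases hedge ⟨g, hg⟩ with hg | hg
      · exact ⟨0, (congrArg Subtype.val hg).symm⟩
      · exact ⟨1, (congrArg Subtype.val hg).symm⟩
  · have hc := h.cycle 1 ![x, y] ![e, f] one_ne_zero hcyc
    have hN : ∑ i : Fin (1 + 1), N (![x, y] i) = N x + N y := by simp
    rw [hN, circulation_pair hf hxy, Pi.sub_apply] at hc
    have hsign : tailSign e x o = tailSign f x o := by
      have : (tailSign e x o - tailSign f x o) ^ 2 ≤ 0 := by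
        push_cast at hc
        linarith
      have := pow_eq_zero_iff two_ne_zero |>.1 (le_antisymm this (sq_nonneg _))
      linarith
    have htail : (o e).tail = x ↔ (o f).tail = x := by
      unfold tailSign at hsign
      split_ifs at hsign with h₁ h₂ h₂ <;> norm_num at hsign <;> simp [h₁, h₂]
    have hhead {g : E(G)} (hg : G.IsLink g x y) (ht : (o g).tail ≠ x) : (o g).head = x :=
      not_not.1 (mt (EdgeOrientation.tail_eq_iff_head_ne hg hxy (o g)).2 ht)
    by_cases hex : (o e).tail = x
    · refine ⟨y, fun g => ?_⟩
      rcases hedge g with rfl | rfl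
      · exact (EdgeOrientation.head_eq_iff_tail_eq he hxy _).2 hex
      · exact (EdgeOrientation.head_eq_iff_tail_eq hf hxy _).2 (htail.1 hex)
    · refine ⟨x, fun g => ?_⟩
      rcases hedge g with rfl | rfl
      · exact hhead he hex
      · exact hhead hf (mt htail.2 hex)

lemma PopBounds.sum_le [Finite V(G)] (h : PopBounds o N) (hne : V(G).Nonempty)
    (htree : G.NoTreeComponent) :
    ∑ x ∈ (Set.toFinite V(G)).toFinset, N x ≤
      (V(G).ncard : ℝ) * ((V(G).ncard : ℝ) - 1) := by
  rw [← card_toFinset_vertexSet]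
  exact (h.isBounded hne htree).sum_le

lemma PopBounds.of_sum_eq [Finite V(G)] (h : PopBounds o N) (hne : V(G).Nonempty)
    (hloop : ∀ x, (G.loopSet x).Subsingleton) (htree : G.NoTreeComponent)
    (hsum : ∑ x ∈ (Set.toFinite V(G)).toFinset, N x =
      (V(G).ncard : ℝ) * ((V(G).ncard : ℝ) - 1)) :
    (G.IsNLollipop V(G).ncard ∧ ∃ σ : G.Orientation, σ.IsSinkFree ∧ o = σ.reverse) ∨
      (V(G).ncard = 2 ∧ G.IsNCycle 2 ∧ ∃ x, ∀ e, (o e).head = x) := by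
  rcases (h.isBounded hne htree).tight (by rw [card_toFinset_vertexSet, hsum]) with hp | hp
  · exact Or.inl (h.isNLollipop hloop hp)
  · exact Or.inr (h.isNCycle_two hsum hp)

/-! ### The sink-free orientation of a lollipop -/

section Lollipop

/-- The vertices `v` and the edges `e` of a lollipop, where `w i` is the end of `e i` that is
farther from the free end of the path. -/
structure IsLollipopIn (G : Graph α β) {k : ℕ} (v w : Fin (k + 1) → α) (e : Fin (k + 1) → E(G)) :
    Prop where
  vertex_injective : Function.Injective v
  edge_injective : Function.Injective e
  edge_surjective : Function.Surjective e
  vertex_surjective : ∀ x ∈ V(G), ∃ i, v i = x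
  isLink : ∀ i, G.IsLink (e i) (v i) (w i)
  castSucc : ∀ i : Fin k, w i.castSucc = v i.succ
  last : w (Fin.last k) = v (Fin.last k)

lemma IsNLollipop.exists_isLollipopIn {n : ℕ} (h : G.IsNLollipop n) :
    ∃ (k : ℕ) (v w : Fin (k + 1) → α) (e : Fin (k + 1) → E(G)),
      n = k + 1 ∧ G.IsLollipopIn v w e := by
  obtain ⟨k, v, e, hn, hv, he, hVv, hEe, hl, hlast⟩ := h
  refine ⟨k, v, Fin.snoc (α := fun _ => α) (fun i => v i.succ) (v (Fin.last k)),
    fun i => ⟨e i, hEe ▸ Set.mem_range_self i⟩, hn, hv,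
    fun i j hij => he (congrArg Subtype.val hij), ?_, ?_, ?_, ?_, ?_⟩
  · rintro ⟨f, hf⟩
    obtain ⟨i, rfl⟩ := hEe ▸ hf
    exact ⟨i, rfl⟩
  · intro x hx
    rwa [← hVv] at hx
  · intro i
    refine Fin.lastCases ?_ (fun i => ?_) i
    · simpa using hlast
    · simpa using hl i
  · intro i
    simp
  · simp

variable {k : ℕ} {v w : Fin (k + 1) → α} {e : Fin (k + 1) → E(G)}

lemma IsLollipopIn.isSinkFree_of_tail (h : G.IsLollipopIn v w e) {σ : G.Orientation}
    (hσ : ∀ i, (σ (e i)).tail = v i) : σ.IsSinkFree := by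
  intro x hx
  obtain ⟨i, rfl⟩ := h.vertex_surjective x hx.1
  exact hx.2 _ (hσ i)

/-- The orientation is forced from the free end: `v 0` can only be the tail of `e 0`, and once `e i`
has tail `v i`, only `e (i + 1)` is left for the next vertex. -/
lemma IsLollipopIn.tail_eq (h : G.IsLollipopIn v w e) {σ : G.Orientation} (hσ : σ.IsSinkFree)
    (i : Fin (k + 1)) : (σ (e i)).tail = v i := by
  induction i using Fin.induction with
  | zero =>
    have := hσ (v 0)
    simp only [Orientation.IsSink, not_and, not_forall, not_not] at this
    obtain ⟨f, hf⟩ := this (h.isLink 0).left_mem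
    obtain ⟨j, rfl⟩ := h.edge_surjective f
    suffices hj : j = 0 by
      subst hj
      exact hf
    rcases (hf ▸ (σ (e j)).inc_tail : G.Inc (e j) (v 0)).eq_or_eq_of_isLink (h.isLink j) with h' | h'
    · exact (h.vertex_injective h').symm
    · revert h'
      refine Fin.lastCases ?_ (fun j => ?_) j
      · rw [h.last]
        exact fun h' => (h.vertex_injective h').symm
      · rw [h.castSucc]
        exact fun h' => absurd (h.vertex_injective h').symm (Fin.succ_ne_zero j)
  | succ i ih =>
    have := hσ (v i.succ)
    simp only [Orientation.IsSink, not_and, not_forall, not_not] at this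
    obtain ⟨f, hf⟩ := this (h.isLink i.succ).left_mem
    obtain ⟨j, rfl⟩ := h.edge_surjective f
    suffices hj : j = i.succ by
      subst hj
      exact hf
    rcases (hf ▸ (σ (e j)).inc_tail : G.Inc (e j) (v i.succ)).eq_or_eq_of_isLink (h.isLink j)
      with h' | h'
    · exact (h.vertex_injective h').symm
    · revert h' hf
      refine Fin.lastCases ?_ (fun j => ?_) j
      · rw [h.last]
        exact fun _ h' => (h.vertex_injective h').symm
      · rw [h.castSucc]
        intro hf h'
        have hij : i = j := Fin.succ_injective _ (h.vertex_injective h')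
        subst hij
        rw [ih] at hf
        exact absurd (h.vertex_injective hf) i.castSucc_lt_succ.ne

lemma EdgeOrientation.ext_tail {e : β} {o o' : G.EdgeOrientation e} (h : o.tail = o'.tail) :
    o = o' := by
  obtain ⟨⟨a, b⟩, ho⟩ := o
  obtain ⟨⟨a', b'⟩, ho'⟩ := o'
  obtain rfl : a = a' := h
  obtain rfl := ho.right_unique ho'
  rfl

lemma IsNLollipop.existsUnique_isSinkFree {n : ℕ} (h : G.IsNLollipop n) :
    ∃! σ : G.Orientation, σ.IsSinkFree := by
  obtain ⟨k, v, w, e, -, h⟩ := h.exists_isLollipopIn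
  let E := Equiv.ofBijective e ⟨h.edge_injective, h.edge_surjective⟩
  have hE (f : E(G)) : e (E.symm f) = f := Equiv.ofBijective_apply_symm_apply e _ f
  let σ : G.Orientation := fun f =>
    ⟨(v (E.symm f), w (E.symm f)), by simpa only [hE] using h.isLink (E.symm f)⟩
  refine ⟨σ, h.isSinkFree_of_tail fun i => ?_, fun σ' hσ' => ?_⟩
  · exact congrArg v (Equiv.ofBijective_symm_apply_apply e _ i)
  · funext f
    refine EdgeOrientation.ext_tail ?_
    have := h.tail_eq hσ' (E.symm f)
    rw [hE] at this
    exact this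

end Lollipop

/-! ### Passage to the limit and sharpness -/

section Convergence

open Filter Topology

lemma popIndicator_le_hasSink [Nonempty α] (x : α) : popIndicator x ≤ (hasSink : G.Orientation → ℝ) := by
  intro o
  unfold popIndicator hasSink
  split_ifs <;> simp_all

variable [Finite V(G)] [Finite E(G)] [Nonempty α]

lemma sum_transition_hasSink (o : G.Orientation) (k : ℕ) :
    ∑ j ∈ Finset.range k, (transition ^ j) hasSink o =
      ∑ x ∈ (Set.toFinite V(G)).toFinset, expectedPops o k x := by
  simp only [hasSink_eq_sum_popIndicator, map_sum, Finset.sum_apply, expectedPops]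
  exact Finset.sum_comm

/-- Termination is not presupposed: the combinatorial bound at finite times is uniform in `k`, and
so bounds the partial sums. -/
lemma summable_transition_hasSink (hne : V(G).Nonempty) (htree : G.NoTreeComponent)
    (o : G.Orientation) : Summable fun j => (transition ^ j) hasSink o :=
  summable_of_sum_range_le (fun j => transition_pow_nonneg hasSink_nonneg j o) fun k => by
    rw [sum_transition_hasSink]
    exact (popBounds_expectedPops o k).sum_le hne htree

/-- The expected number of times that `x` is popped, starting from `o`. -/
def totalPops (o : G.Orientation) (x : α) : ℝ := ∑' j, (transition ^ j) (popIndicator x) o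

lemma hasSum_totalPops (hne : V(G).Nonempty) (htree : G.NoTreeComponent) (o : G.Orientation)
    (x : α) : HasSum (fun j => (transition ^ j) (popIndicator x) o) (totalPops o x) :=
  (Summable.of_nonneg_of_le (fun j => transition_pow_nonneg (popIndicator_nonneg x) j o)
    (fun j => transition_pow_mono (popIndicator_le_hasSink x) j o)
    (summable_transition_hasSink hne htree o)).hasSum

lemma tendsto_expectedPops (hne : V(G).Nonempty) (htree : G.NoTreeComponent)
    (o : G.Orientation) (x : α) :
    Tendsto (fun k => expectedPops o k x) atTop (𝓝 (totalPops o x)) :=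
  (hasSum_totalPops hne htree o x).tendsto_sum_nat

lemma popBounds_totalPops (hne : V(G).Nonempty) (htree : G.NoTreeComponent)
    (o : G.Orientation) : PopBounds o (totalPops o) :=
  PopBounds.of_tendsto (popBounds_expectedPops o) (tendsto_expectedPops hne htree o)

lemma expectedTime_eq (hne : V(G).Nonempty) (htree : G.NoTreeComponent) (o : G.Orientation) :
    expectedTime o =
      ENNReal.ofReal (∑ x ∈ (Set.toFinite V(G)).toFinset, totalPops o x) := by
  rw [expectedTime, ← ENNReal.ofReal_tsum_of_nonneg
    (fun j => transition_pow_nonneg hasSink_nonneg j o) (summable_transition_hasSink hne htree o)]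
  congr 1
  refine HasSum.tsum_eq ?_
  simp only [hasSink_eq_sum_popIndicator, map_sum, Finset.sum_apply]
  exact hasSum_sum fun x _ => hasSum_totalPops hne htree o x

lemma tendsto_transition_hasSink (hne : V(G).Nonempty) (htree : G.NoTreeComponent)
    (o : G.Orientation) : Tendsto (fun k => (transition ^ k) hasSink o) atTop (𝓝 0) :=
  (summable_transition_hasSink hne htree o).tendsto_atTop_zero

/-- In the limit the expectation of `f` is at least `c` if `f ≥ c` on sink-free orientations. -/
lemma transition_pow_ge (f : G.Orientation → ℝ) (c d : ℝ)
    (hf : ∀ o, c - d * hasSink o ≤ f o) (k : ℕ) (o : G.Orientation) :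
    c - d * (transition ^ k) hasSink o ≤ (transition ^ k) f o := by
  have := transition_pow_mono (f := c • (1 : G.Orientation → ℝ) - d • hasSink) (g := f)
    (fun o => by simpa using hf o) k o
  simpa [transition_pow_one] using this

/-- The sign of `e` at `x` starts at `-1`, and its expectation tends to `1` because all sink-free
orientations agree on `e`. -/
lemma totalPops_add_two_le (hne : V(G).Nonempty) (htree : G.NoTreeComponent)
    {o : G.Orientation} {e : E(G)} {x y : α} (h : G.IsLink e x y) (hxy : x ≠ y)
    (ho : (o e).tail ≠ x) (hsf : ∀ σ : G.Orientation, σ.IsSinkFree → (σ e).tail = x) :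
    totalPops o y + 2 ≤ totalPops o x := by
  have hlim := ((tendsto_expectedPops hne htree o y).add
    (((tendsto_transition_hasSink hne htree o).const_mul 2).const_sub 2))
  rw [mul_zero, sub_zero] at hlim
  refine le_of_tendsto_of_tendsto' hlim (tendsto_expectedPops hne htree o x) fun k => ?_
  have h₁ := expectedPops_sub h hxy o k
  have h₂ : tailSign e x o = -1 := by simp [tailSign, ho]
  have h₃ := transition_pow_ge (tailSign e x) 1 2 (fun σ => by
    by_cases hσ : σ.IsSinkFree
    · simp [hasSink, hσ, tailSign, hsf σ hσ]
    · rcases tailSign_eq_or e x σ with h | h <;> rw [h] <;>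
        (simp only [hasSink, hσ, if_false]; norm_num)) k o
  linarith

lemma IsLollipopIn.le_sum_totalPops (hne : V(G).Nonempty) (htree : G.NoTreeComponent)
    {k : ℕ} {v w : Fin (k + 1) → α} {e : Fin (k + 1) → E(G)} (h : G.IsLollipopIn v w e)
    {σ : G.Orientation} (hσ : σ.IsSinkFree) :
    (k + 1 : ℝ) * k ≤ ∑ x ∈ (Set.toFinite V(G)).toFinset, totalPops σ.reverse x := by
  have hb := popBounds_totalPops hne htree σ.reverse
  -- From the loop backwards, each edge contributes a gap of at least `2`.
  have hval (i : Fin (k + 1)) : 2 * ((k : ℝ) - (i : ℕ)) ≤ totalPops σ.reverse (v i) := by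
    induction i using Fin.reverseInduction with
    | last => simpa using hb.nonneg _
    | cast i ih =>
      have hl := h.isLink i.castSucc
      rw [h.castSucc] at hl
      have hne' : v i.castSucc ≠ v i.succ := h.vertex_injective.ne i.castSucc_lt_succ.ne
      have := totalPops_add_two_le (o := σ.reverse) hne htree hl hne' ?_
        fun σ' hσ' => h.tail_eq hσ' _
      · simp only [Fin.val_castSucc, Fin.val_succ] at ih ⊢
        push_cast at ih
        linarith
      · exact (EdgeOrientation.tail_eq_iff_head_ne hl hne' _).1 (h.tail_eq hσ _)
  have hV : (Set.toFinite V(G)).toFinset = Finset.univ.image v := by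
    ext x
    simp only [Set.Finite.mem_toFinset, Finset.mem_image, Finset.mem_univ, true_and]
    constructor
    · exact h.vertex_surjective x
    · rintro ⟨i, rfl⟩
      exact (h.isLink i).left_mem
  rw [hV, Finset.sum_image h.vertex_injective.injOn]
  refine le_trans (le_of_eq ?_) (Finset.sum_le_sum fun i _ => hval i)
  rw [← Finset.mul_sum, Finset.sum_sub_distrib, Fin.sum_univ_eq_sum_range (fun j => (j : ℝ)),
    ← Nat.cast_sum]
  have hgauss := Finset.sum_range_id_mul_two (k + 1)
  rw [Nat.add_sub_cancel] at hgauss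
  have hgauss' : ((∑ j ∈ Finset.range (k + 1), j : ℕ) : ℝ) * 2 = (k + 1) * k := by
    exact_mod_cast hgauss
  simp only [Finset.sum_const, Finset.card_univ, Fintype.card_fin, nsmul_eq_mul]
  push_cast at hgauss' ⊢
  linarith

lemma IsNCycle.le_sum_totalPops (hne : V(G).Nonempty) (htree : G.NoTreeComponent)
    (h : G.IsNCycle 2) {o : G.Orientation} {z : α} (ho : ∀ e, (o e).head = z) :
    2 ≤ ∑ x ∈ (Set.toFinite V(G)).toFinset, totalPops o x := by
  obtain ⟨k, v, e, hk, hc, hv, he⟩ := h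
  obtain rfl : k = 1 := by omega
  have hxy : v 0 ≠ v 1 := hc.vertex_injective.ne (by simp)
  set x := v 0
  set y := v 1
  have hl₀ : G.IsLink (e 0) x y := hc.isLink 0
  have hl₁ : G.IsLink (e 1) x y := (hc.isLink 1).symm
  let f : E(G) := ⟨e 0, hl₀.edge_mem⟩
  let g : E(G) := ⟨e 1, hl₁.edge_mem⟩
  have hfg : f ≠ g := fun h => absurd (hc.edge_injective (congrArg Subtype.val h)) (by simp)
  have hedge (a : E(G)) : a = f ∨ a = g := by
    obtain ⟨i, hi⟩ : (a : β) ∈ Set.range e := by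
      rw [he]
      exact a.2
    have : ∀ i, e i = a → a = f ∨ a = g := by
      rw [Fin.forall_fin_two]
      exact ⟨fun h => .inl (Subtype.ext h.symm), fun h => .inr (Subtype.ext h.symm)⟩
    exact this i hi
  have hV : (Set.toFinite V(G)).toFinset = {x, y} := by
    ext a
    rw [Set.Finite.mem_toFinset, ← hv]
    simp [Fin.exists_fin_two, eq_comm, x, y]
  rw [hV, Finset.sum_pair hxy]
  have htail : (o f).tail = x ↔ (o g).tail = x := by
    rw [← EdgeOrientation.head_eq_iff_tail_eq hl₀ hxy, ← EdgeOrientation.head_eq_iff_tail_eq hl₁ hxy,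
      ho, ho]
  have hsign : tailSign f x o = tailSign g x o := by simp [tailSign, htail]
  have hlim := ((tendsto_transition_hasSink hne htree o).const_mul 2).const_sub 2
  rw [mul_zero, sub_zero] at hlim
  refine le_of_tendsto_of_tendsto' hlim ((tendsto_expectedPops hne htree o x).add
    (tendsto_expectedPops hne htree o y)) fun k => ?_
  -- The squared circulation starts at `0` and equals `4` on every sink-free orientation, where the
  -- two edges have different tails.
  have h₁ := two_mul_expectedPops_add (e := f) (f := g) hl₀ hl₁ hxy hfg o k
  have h₂ := transition_pow_ge ((tailSign f x - tailSign g x) ^ 2) 4 4 (fun σ => by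
    by_cases hσ : σ.IsSinkFree
    · have hx : (σ f).tail = x ∨ (σ g).tail = x := by
        have := hσ x
        simp only [Orientation.IsSink, not_and, not_forall, not_not] at this
        obtain ⟨a, ha⟩ := this hl₀.left_mem
        rcases hedge a with rfl | rfl
        · exact .inl ha
        · exact .inr ha
      have hy : (σ f).tail = y ∨ (σ g).tail = y := by
        have := hσ y
        simp only [Orientation.IsSink, not_and, not_forall, not_not] at this
        obtain ⟨a, ha⟩ := this hl₀.right_mem
        rcases hedge a with rfl | rfl
        · exact .inl ha
        · exact .inr ha
      rw [EdgeOrientation.tail_eq_iff_tail_ne hl₀.symm hxy.symm,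
        EdgeOrientation.tail_eq_iff_tail_ne hl₁.symm hxy.symm] at hy
      simp only [Pi.pow_apply, Pi.sub_apply, hasSink, hσ, if_true, tailSign]
      by_cases h₁ : (σ f).tail = x <;> by_cases h₂ : (σ g).tail = x <;> simp_all <;> norm_num
    · simp only [hasSink, hσ, Pi.pow_apply, Pi.sub_apply, if_false]
      nlinarith [sq_nonneg (tailSign f x σ - tailSign g x σ)]) k o
  rw [hsign, sub_self] at h₁
  linarith

end Convergence

lemma expectedTime_le_and_eq_iff [Finite V(G)] [Finite E(G)] [Nonempty α] (hne : V(G).Nonempty)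
    (hloop : ∀ x, (G.loopSet x).Subsingleton) (htree : G.NoTreeComponent) {n : ℕ}
    (hn : V(G).ncard = n) (o : G.Orientation) :
    expectedTime o ≤ ((n * (n - 1) : ℕ) : ℝ≥0∞) ∧
    (expectedTime o = ((n * (n - 1) : ℕ) : ℝ≥0∞) ↔
      (G.IsNLollipop n ∧ ∃ σ : G.Orientation, σ.IsSinkFree ∧ o = σ.reverse) ∨
        (n = 2 ∧ G.IsNCycle 2 ∧ ∃ x, ∀ e, (o e).head = x)) := by
  subst hn
  have hb := popBounds_totalPops hne htree o
  have hpos : 1 ≤ V(G).ncard := (Set.ncard_pos (Set.toFinite _)).2 hne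
  have hcast : ((V(G).ncard * (V(G).ncard - 1) : ℕ) : ℝ) =
      (V(G).ncard : ℝ) * ((V(G).ncard : ℝ) - 1) := by
    rw [Nat.cast_mul, Nat.cast_sub hpos, Nat.cast_one]
  have hle := hb.sum_le hne htree
  rw [expectedTime_eq hne htree, ← ENNReal.ofReal_natCast, hcast]
  refine ⟨ENNReal.ofReal_le_ofReal hle, ?_⟩
  rw [ENNReal.ofReal_eq_ofReal_iff (Finset.sum_nonneg fun x _ => hb.nonneg x)
    (hcast ▸ Nat.cast_nonneg _)]
  refine ⟨hb.of_sum_eq hne hloop htree, ?_⟩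
  rintro (⟨hG, σ, hσ, rfl⟩ | ⟨h2, hG, x, hx⟩)
  · obtain ⟨k, v, w, e, hk, h⟩ := hG.exists_isLollipopIn
    refine le_antisymm hle (le_trans (le_of_eq ?_) (h.le_sum_totalPops hne htree hσ))
    rw [hk]
    push_cast
    ring
  · refine le_antisymm hle (le_trans (le_of_eq ?_) (hG.le_sum_totalPops hne htree hx))
    rw [h2]
    norm_num

end Graph

end

theorem mainTheorem6 {α β : Type*} (G : Graph α β) [Finite V(G)] [Finite E(G)]
    (hne : V(G).Nonempty)
    (hloop : ∀ x, (G.loopSet x).Subsingleton)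
    (htree : G.NoTreeComponent)
    (n : ℕ) (hn : V(G).ncard = n)
    (c : G.Stacks → ℕ → α) (hc : G.IsChoiceRule c) :
    Measurable (Graph.runningTime c) ∧
    (∀ᵐ ω ∂G.stackMeasure,
      G.stackMeasure⁻[Graph.runningTime c | G.initialSigma] ω ≤ ((n * (n - 1) : ℕ) : ℝ≥0∞)) ∧
    (∀ᵐ ω ∂G.stackMeasure,
      (G.stackMeasure⁻[Graph.runningTime c | G.initialSigma] ω = ((n * (n - 1) : ℕ) : ℝ≥0∞) ↔
        (G.IsNLollipop n ∧ ∃ σ : G.Orientation, σ.IsSinkFree ∧ ω 0 = σ.reverse) ∨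
        (n = 2 ∧ G.IsNCycle 2 ∧ ∃ x, ∀ e, (ω 0 e).head = x))) ∧
    (G.IsNLollipop n → ∃! σ : G.Orientation, σ.IsSinkFree) := by
  have : Nonempty α := ⟨hne.some⟩
  refine ⟨?_, ?_, ?_, fun h => h.existsUnique_isSinkFree⟩
  · rw [Graph.runningTime_congr hc (Graph.isChoiceRule_canonicalRule G)]
    exact Graph.measurable_runningTime_canonicalRule
  · filter_upwards [Graph.condLExp_runningTime hc] with ω hω
    rw [← hω]
    exact (Graph.expectedTime_le_and_eq_iff hne hloop htree hn (ω 0)).1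
  · filter_upwards [Graph.condLExp_runningTime hc] with ω hω
    rw [← hω]
    exact (Graph.expectedTime_le_and_eq_iff hne hloop htree hn (ω 0)).2
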